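/- A \emph{mosaic tile} is a square carrying one of the following eleven pictures $T_0,\dots,T_{10}$, whose curves end at midpoints of sides of the square (the \emph{connection points}): the blank tile $T_0$; a single arc joining the midpoints of two adjacent sides (four tiles $T_1$–$T_4$); a straight segment joining the midpoints of two opposite sides (two tiles $T_5,T_6$); two disjoint arcs, each joining the midpoints of two adjacent sides (two tiles $T_7,T_8$); a crossing of the horizontal and the vertical segment, with either of them on top (two tiles $T_9,T_{10}$). An \emph{$n$-mosaic} is an $n\times n$ array of tiles in which every connection point of a tile touches a connection point of an adjacent tile. It is a diagram of an (unoriented) link, and it \emph{represents} a link type $K$ if its diagram is a diagram of $K$, where the link type of a diagram is its class up to planar isotopy and Reidemeister moves. The \emph{tile number of a mosaic} is the number of its tiles different from $T_0$. For a link type $K$, the \emph{mosaic number} of $K$ is the smallest $n$ such that some $n$-mosaic represents $K$; the \emph{tile number} $t(K)$ is the smallest tile number of all mosaics (of any size) that represent $K$; and the \emph{minimal mosaic tile number} $t_M(K)$ is the smallest tile number of all $m$-mosaics that represent $K$, where $m$ is the mosaic number of $K$. \textbf{Corollary.} Let $K$ be the trefoil knot $3_1$, the Hopf link $2^2_1$,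 or Solomon's knot $4^2_1$ (the closures of the two-strand braids $\sigma_1^3$, $\sigma_1^2$ and $\sigma_1^4$, respectively), or the mirror image of one of them. Then $$t(K)=t_M(K)=12 .$$ -/

import Mathlib

namespace KnotMosaic

/-! ### Unoriented link diagrams as planar diagram codes

A link diagram is cut into finitely many elementary pieces: plain arcs and crossings. Every place
where two pieces are glued together gets a label (a natural number). -/

/-- A piece of a link diagram.
* `arc a b` is a crossingless arc with end points `a` and `b`.
* `crossing a b c d` is a crossing whose four ends, read counterclockwise in the plane, are
  `a, b, c, d`; the under-strand joins `a` to `c` and the over-strand joins `b` to `d`. -/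
inductive Piece where
  | arc (a b : ℕ)
  | crossing (a b c d : ℕ)
  deriving DecidableEq

/-- The ends of a piece, read counterclockwise. -/
def Piece.ends : Piece → List ℕ
  | .arc a b => [a, b]
  | .crossing a b c d => [a, b, c, d]

/-- The same piece with the over- and the under-strand exchanged. -/
def Piece.mirror : Piece → Piece
  | .arc a b => .arc a b
  | .crossing a b c d => .crossing b c d a

/-- A planar diagram code: a finite list of pieces. Ends with the same label are glued together.
The code `[arc a a]` is a crossingless circle, and `[]` is the empty diagram. -/
abbrev Diagram := List Piece

namespace Diagram

/-- The labels of all ends of all pieces, with repetition. -/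
def labels (D : Diagram) : List ℕ := D.flatMap Piece.ends

/-- Every label that occurs is the label of exactly two ends, so that the pieces close up to a
diagram without loose ends. -/
def IsClosed (D : Diagram) : Prop := ∀ a ∈ D.labels, D.labels.count a = 2

/-- The mirror image of a diagram: all crossings are changed. -/
def mirror (D : Diagram) : Diagram := D.map Piece.mirror

/-- The ends of the pieces of `D`: the index of a piece, and the position of the end in it. -/
abbrev End (D : Diagram) : Type := Σ k : Fin D.length, Fin (D[k].ends.length)

/-- The label of an end. -/
def End.label {D : Diagram} (x : D.End) : ℕ := D[x.1].ends[x.2]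

/-- The counterclockwise next end of the same piece. -/
def End.next {D : Diagram} (x : D.End) : D.End := ⟨x.1, finRotate _ x.2⟩

/-- Every end `x` stands for the corner of its piece that lies between `x` and `x.next` in
counterclockwise order. The corner `y` follows the corner `x` along the boundary of a region when
the end `x.next` is glued to the end `y`. -/
def FollowingCorner {D : Diagram} (x y : D.End) : Prop := x.next ≠ y ∧ x.next.label = y.label

/-- The graph on the corners of `D` in which corners consecutive along the boundary of a region are
adjacent; its connected components are the regions (faces) of the diagram, counted separately for
each connected piece of the diagram. -/
def regionGraph (D : Diagram) : SimpleGraph D.End := SimpleGraph.fromRel FollowingCorner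

/-- The graph on the pieces of `D` in which pieces that are glued to each other are adjacent. -/
def pieceGraph (D : Diagram) : SimpleGraph (Fin D.length) :=
  SimpleGraph.fromRel fun k l => ∃ a, a ∈ D[k].ends ∧ a ∈ D[l].ends

/-- The code is the code of a diagram on the sphere (equivalently, in the plane): the Euler
characteristic `V - E + F` of the surface that it describes is twice the number of connected
components, so that each connected component of the surface is a sphere. -/
def IsPlanar (D : Diagram) : Prop :=
  D.length + Nat.card D.regionGraph.ConnectedComponent =
    D.labels.toFinset.card + 2 * Nat.card D.pieceGraph.ConnectedComponent

open Piece in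
/-- The elementary changes of a diagram code: those that describe the same diagram by another code
(`perm`, …, `crossing_arc'`), and the Reidemeister moves. Throughout, `Γ` is the rest of the
diagram, which does not change. -/
inductive Move : Diagram → Diagram → Prop
  /-- The order of the pieces is irrelevant. -/
  | perm {D D' : Diagram} : D.Perm D' → Move D D'
  /-- The two ends of an arc play the same role. -/
  | arc_symm (a b : ℕ) (Γ : Diagram) : Move (arc a b :: Γ) (arc b a :: Γ)
  /-- A crossing may be read from either end of its under-strand. -/
  | crossing_symm (a b c d : ℕ) (Γ : Diagram) :
      Move (crossing a b c d :: Γ) (crossing c d a b :: Γ)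
  /-- Two arcs glued at an end form one arc. -/
  | arc_arc (a b c : ℕ) (Γ : Diagram) : Move (arc a b :: arc b c :: Γ) (arc a c :: Γ)
  /-- An arc glued to an end of the over-strand of a crossing is absorbed. -/
  | crossing_arc (a b c d e : ℕ) (Γ : Diagram) :
      Move (crossing a b c d :: arc d e :: Γ) (crossing a b c e :: Γ)
  /-- An arc glued to an end of the under-strand of a crossing is absorbed. -/
  | crossing_arc' (a b c d e : ℕ) (Γ : Diagram) :
      Move (crossing a b c d :: arc c e :: Γ) (crossing a b e d :: Γ)
  /-- First Reidemeister move: a kink is removed. -/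
  | r1 (a b c : ℕ) (Γ : Diagram) : Move (crossing a b b c :: Γ) (arc a c :: Γ)
  /-- First Reidemeister move: the kink with the other crossing. -/
  | r1' (a b c : ℕ) (Γ : Diagram) : Move (crossing b b a c :: Γ) (arc a c :: Γ)
  /-- Second Reidemeister move: the strand from `p` to `q` passes over the strand from `r` to `s` at
  both corners of a bigon with edges `m` and `n`. The diagram with the bigon has to be planar: when
  the move is used to create the bigon, this says that the two strands border a common region (or
  belong to different connected pieces of the diagram). All other moves keep planar diagrams planar
  in both directions. -/
  | r2 (p q r s m n : ℕ) (Γ : Diagram) :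
      IsPlanar (crossing r p m n :: crossing m q s n :: Γ) →
      Move (crossing r p m n :: crossing m q s n :: Γ) (arc p q :: arc r s :: Γ)
  /-- Third Reidemeister move: `b₁b₂` is the bottom, `m₁m₂` the middle and `t₁t₂` the top strand;
  the ends are in the counterclockwise order `b₁, m₁, t₁, b₂, m₂, t₂`, and `u, v, w` are the edges
  of the triangle on the middle, bottom and top strand. -/
  | r3 (b₁ m₁ t₁ b₂ m₂ t₂ u v w : ℕ) (Γ : Diagram) :
      Move (crossing b₁ m₁ v u :: crossing b₂ w v t₁ :: crossing m₂ t₂ u w :: Γ)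
        (crossing b₂ m₂ v u :: crossing b₁ w v t₂ :: crossing m₁ t₁ u w :: Γ)
  /-- Third Reidemeister move for the counterclockwise order `b₁, t₁, m₁, b₂, t₂, m₂`. -/
  | r3' (b₁ m₁ t₁ b₂ m₂ t₂ u v w : ℕ) (Γ : Diagram) :
      Move (crossing b₁ u v m₁ :: crossing b₂ t₁ v w :: crossing m₂ w u t₂ :: Γ)
        (crossing b₂ u v m₂ :: crossing b₁ t₂ v w :: crossing m₁ w u t₁ :: Γ)

/-- A step from one closed diagram to another one by an elementary change. (That both codes are
closed forces the labels that a change introduces to be new.) -/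
def Step (D D' : Diagram) : Prop := D.IsClosed ∧ D'.IsClosed ∧ Move D D'

end Diagram

/-- Unoriented link types: diagrams up to the equivalence relation that is generated by the
Reidemeister moves (and by the changes of the code that do not change the diagram). -/
def LinkType : Type := Quot Diagram.Step

/-- The link type of a diagram. -/
def Diagram.linkType (D : Diagram) : LinkType := Quot.mk _ D

/-! ### The trefoil, the Hopf link and Solomon's knot -/

open Piece in
/-- The standard three-crossing diagram of the trefoil `3₁`: the closure of the braid `σ₁³`. -/
def trefoil : Diagram := [crossing 0 1 3 2, crossing 2 3 5 4, crossing 4 5 1 0]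

open Piece in
/-- The standard two-crossing diagram of the Hopf link `2²₁`: the closure of the braid `σ₁²`. -/
def hopfLink : Diagram := [crossing 0 1 3 2, crossing 2 3 1 0]

open Piece in
/-- The standard four-crossing diagram of Solomon's knot `4²₁`: the closure of the braid `σ₁⁴`. -/
def solomonKnot : Diagram :=
  [crossing 0 1 3 2, crossing 2 3 5 4, crossing 4 5 7 6, crossing 6 7 1 0]

/-! ### Knot mosaics -/

/-- The four sides of a tile. -/
inductive Side where
  | left | bottom | right | top
  deriving DecidableEq

/-- The eleven mosaic tiles. -/
inductive Tile where
  /-- the blank tile -/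
  | t0
  /-- a single arc joining left and bottom -/
  | t1
  /-- a single arc joining bottom and right -/
  | t2
  /-- a single arc joining right and top -/
  | t3
  /-- a single arc joining top and left -/
  | t4
  /-- a horizontal line segment -/
  | t5
  /-- a vertical line segment -/
  | t6
  /-- two arcs, one joining left and bottom and one joining right and top -/
  | t7
  /-- two arcs, one joining top and left and one joining bottom and right -/
  | t8
  /-- a crossing with the vertical strand over the horizontal one -/
  | t9
  /-- a crossing with the horizontal strand over the vertical one -/
  | t10
  deriving DecidableEq

/-- The part of a link diagram drawn on a tile, when the ends at the midpoints of its sides are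
labelled by `e`. (Counterclockwise, the sides are left, bottom, right, top.) -/
def Tile.pieces (e : Side → ℕ) : Tile → List Piece
  | .t0 => []
  | .t1 => [.arc (e .left) (e .bottom)]
  | .t2 => [.arc (e .bottom) (e .right)]
  | .t3 => [.arc (e .right) (e .top)]
  | .t4 => [.arc (e .top) (e .left)]
  | .t5 => [.arc (e .left) (e .right)]
  | .t6 => [.arc (e .bottom) (e .top)]
  | .t7 => [.arc (e .left) (e .bottom), .arc (e .right) (e .top)]
  | .t8 => [.arc (e .top) (e .left), .arc (e .bottom) (e .right)]
  | .t9 => [.crossing (e .left) (e .bottom) (e .right) (e .top)]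
  | .t10 => [.crossing (e .bottom) (e .right) (e .top) (e .left)]

/-- The sides of a tile whose midpoints are connection points. -/
def Tile.connections : Tile → List Side
  | .t0 => []
  | .t1 => [.left, .bottom]
  | .t2 => [.bottom, .right]
  | .t3 => [.right, .top]
  | .t4 => [.top, .left]
  | .t5 => [.left, .right]
  | .t6 => [.bottom, .top]
  | .t7 | .t8 | .t9 | .t10 => [.left, .bottom, .right, .top]

/-- The midpoint of a side of the tile in row `i` and column `j` (both counted from `0`, rows
downwards). Tiles have side length `2`, and the point `(x, y)` lies `x` below the top edge of the
mosaic and `y` to the right of its left edge. -/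
def midpoint (i j : ℕ) : Side → ℕ × ℕ
  | .left => (2 * i + 1, 2 * j)
  | .bottom => (2 * i + 2, 2 * j + 1)
  | .right => (2 * i + 1, 2 * j + 2)
  | .top => (2 * i, 2 * j + 1)

/-- An `n`-mosaic: an `n × n` array of suitably connected tiles, that is, each connection point of a
tile touches a connection point of another (necessarily adjacent) tile. -/
structure Mosaic (n : ℕ) where
  /-- the tile in row `i` and column `j` -/
  tile : Fin n → Fin n → Tile
  suitablyConnected : ∀ i j : Fin n, ∀ s ∈ (tile i j).connections,
    ∃ i' j' : Fin n, (i', j') ≠ (i, j) ∧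
      ∃ s' ∈ (tile i' j').connections, midpoint i' j' s' = midpoint i j s

namespace Mosaic

variable {n : ℕ}

/-- The link diagram drawn on a mosaic; the midpoint `(x, y)` gets the label `Nat.pair x y`. -/
def diagram (M : Mosaic n) : Diagram :=
  (List.finRange n).flatMap fun i => (List.finRange n).flatMap fun j =>
    (M.tile i j).pieces fun s => Nat.pair (midpoint i j s).1 (midpoint i j s).2

/-- The tile number of a mosaic: the number of its non-blank tiles. -/
def tileNumber (M : Mosaic n) : ℕ :=
  (Finset.univ.filter fun p : Fin n × Fin n => M.tile p.1 p.2 ≠ .t0).card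

/-- The mosaic `M` represents the link type `K`. -/
def Represents (M : Mosaic n) (K : LinkType) : Prop := M.diagram.linkType = K

end Mosaic

namespace LinkType

/-- `m` is the mosaic number of `K`: the smallest `n` such that `K` is represented by an
`n`-mosaic. -/
def HasMosaicNumber (K : LinkType) (m : ℕ) : Prop :=
  IsLeast {n : ℕ | ∃ M : Mosaic n, M.Represents K} m

/-- `t` is the tile number of `K`: the smallest tile number of all mosaics, of any size, that
represent `K`. -/
def HasTileNumber (K : LinkType) (t : ℕ) : Prop :=
  IsLeast {t : ℕ | ∃ n : ℕ, ∃ M : Mosaic n, M.Represents K ∧ M.tileNumber = t} t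

/-- `t` is the minimal mosaic tile number of `K`: the smallest tile number of all minimal mosaics of
`K`, that is, of all `m`-mosaics that represent `K`, where `m` is the mosaic number of `K`. -/
def HasMinimalMosaicTileNumber (K : LinkType) (t : ℕ) : Prop :=
  ∃ m : ℕ, K.HasMosaicNumber m ∧
    IsLeast {t : ℕ | ∃ M : Mosaic m, M.Represents K ∧ M.tileNumber = t} t

end LinkType

end KnotMosaic

/-! The lower bound rests on one observation: a mosaic with at most eleven tiles has a nonconstant
Fox colouring modulo 2 if and only if it has one modulo 3. Existence of such colourings is invariant
under Reidemeister moves (`colorable_iff_of_linkType_eq`). The closure of `σ₁^k` has one modulo `p`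
exactly when `p` divides `k`, so the trefoil has one only modulo 3, and the Hopf link and Solomon's
knot only modulo 2.

The geometry is that of even edge sets (flows modulo 2) on the square grid. Such a set passes every
grid line an even number of times, which bounds the number of cells it meets from below. Hence a
mosaic with at most eleven tiles has at most two tiles with four connection points
(`IsFlow.card_full_le_two`), and in particular at most two crossings.

From 2 to 3: a colouring modulo 2 splits the diagram into two flows. If they cross at all, they
cross at least twice by parity (`IsFlow.sum_intersection`); then they meet at least 14 cells in
total (`fourteen_le_of_cross`), of which at most two are shared, so there are at least twelve tiles.
Otherwise the two colours never cross each other, and the colouring can be read modulo 3.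

From 3 to 2: the indicator function of a suitable colour is a colouring modulo 2. It could fail only
at crossings, the number of failures is even, and one crossing is known not to fail; two failures
would thus require three crossings.

Explicit 4-mosaics with twelve tiles give the upper bound. As a 3-mosaic has only nine tiles, 4 is
the mosaic number. -/

namespace KnotMosaic

/-! ### Fox colourings -/

/-- The relation that a Fox colouring `f` of the labels has to satisfy at a piece. -/
def Piece.IsColored {A : Type*} [AddCommGroup A] (f : ℕ → A) : Piece → Prop
  | .arc a b => f a = f b
  | .crossing a b c d => f b = f d ∧ f a + f c = f b + f d

namespace Diagram

variable {A : Type*} [AddCommGroup A]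

/-- A Fox colouring of a diagram with values in an abelian group. -/
def IsColoring (D : Diagram) (f : ℕ → A) : Prop := ∀ P ∈ D, P.IsColored f

variable (A) in
/-- The diagram has a nonconstant Fox colouring with values in `A`. -/
def Colorable (D : Diagram) : Prop :=
  ∃ f : ℕ → A, D.IsColoring f ∧ ∃ a ∈ D.labels, ∃ b ∈ D.labels, f a ≠ f b

theorem labels_append (D E : Diagram) : labels (D ++ E) = labels D ++ labels E :=
  List.flatMap_append

theorem Perm.labels {D E : Diagram} (h : D.Perm E) : (labels D).Perm (labels E) :=
  h.flatMap_right _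

theorem IsClosed.of_labels_perm {D E : Diagram} (h : D.IsClosed) (hp : (labels D).Perm (labels E)) :
    E.IsClosed := fun a ha => by
  rw [← hp.count_eq]
  exact h a (hp.mem_iff.2 ha)

theorem _root_.KnotMosaic.Piece.IsColored.congr {P : Piece} {f g : ℕ → A}
    (h : ∀ a ∈ P.ends, g a = f a) (hf : P.IsColored f) : P.IsColored g := by
  cases P <;> simp_all [Piece.IsColored, Piece.ends]

/-- Transfer of a nonconstant colouring along a local change of a diagram. -/
theorem Colorable.transfer {L L' Γ : Diagram} {f g : ℕ → A}
    (hf : IsColoring (L ++ Γ) f)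
    (hne : ∃ a ∈ labels (L ++ Γ), ∃ b ∈ labels (L ++ Γ), f a ≠ f b)
    (hΓ : ∀ a ∈ labels Γ, g a = f a) (hL' : IsColoring L' g) {a₀ : ℕ} (ha₀ : a₀ ∈ labels L')
    (hc : (∀ a ∈ labels L', g a = g a₀) → ∀ a ∈ labels L, f a = g a₀) :
    Colorable A (L' ++ Γ) := by
  refine ⟨g, fun P hP => ?_, ?_⟩
  · rcases List.mem_append.1 hP with hP | hP
    · exact hL' P hP
    · exact (hf P (List.mem_append_right _ hP)).congr fun a ha =>
        hΓ a (List.mem_flatMap.2 ⟨P, hP, ha⟩)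
  · by_contra! hcon
    simp only [labels_append, List.mem_append] at hne hcon
    have h0 : ∀ a, a ∈ labels L' ∨ a ∈ labels Γ → g a = g a₀ :=
      fun a ha => hcon a ha a₀ (Or.inl ha₀)
    have h1 : ∀ a, a ∈ labels L ∨ a ∈ labels Γ → f a = g a₀ := by
      rintro a (ha | ha)
      · exact hc (fun a ha => h0 a (Or.inl ha)) a ha
      · rw [← hΓ a ha, h0 a (Or.inr ha)]
    obtain ⟨a, ha, b, hb, hab⟩ := hne
    exact hab ((h1 a ha).trans (h1 b hb).symm)

theorem IsClosed.count_add {L Γ : Diagram} (h : IsClosed (L ++ Γ)) {x : ℕ} (hx : x ∈ labels L) :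
    (labels L).count x + (labels Γ).count x = 2 := by
  rw [← List.count_append, ← labels_append]
  exact h x (by simp [labels_append, hx])

theorem IsClosed.notMem {L Γ : Diagram} (h : IsClosed (L ++ Γ)) {x : ℕ}
    (hx : 2 ≤ (labels L).count x) : x ∉ labels Γ := by
  have h1 := h.count_add (x := x) (List.count_pos_iff.1 (by omega))
  rw [← List.count_pos_iff]
  omega

theorem IsClosed.count_eq {L Γ : Diagram} (h : IsClosed (L ++ Γ)) {x : ℕ}
    (hx : 2 ≤ (labels L).count x) : (labels L).count x = 2 := by
  have h1 := h.count_add (x := x) (List.count_pos_iff.1 (by omega))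
  omega

open Piece

/-- The six outer ends keep their colours and only the triangle is recoloured. This is legitimate
because in a closed diagram `u`, `v`, `w` already occur twice inside the triangle, so they are
neither outer ends nor labels of `Γ`. -/
theorem colorable_r3 {b₁ m₁ t₁ b₂ m₂ t₂ u v w : ℕ} {Γ : Diagram}
    (hD : IsClosed ([crossing b₁ m₁ v u, crossing b₂ w v t₁, crossing m₂ t₂ u w] ++ Γ))
    (h : Colorable A ([crossing b₁ m₁ v u, crossing b₂ w v t₁, crossing m₂ t₂ u w] ++ Γ)) :
    Colorable A ([crossing b₂ m₂ v u, crossing b₁ w v t₂, crossing m₁ t₁ u w] ++ Γ) := by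
  obtain ⟨f, hf, hne⟩ := h
  have hu := hD.notMem (x := u) (by simp [labels, ends, List.count_cons]; omega)
  have hv := hD.notMem (x := v) (by simp [labels, ends, List.count_cons]; omega)
  have hw := hD.notMem (x := w) (by simp [labels, ends, List.count_cons]; omega)
  have hu' := hD.count_eq (x := u) (by simp [labels, ends, List.count_cons]; omega)
  have hv' := hD.count_eq (x := v) (by simp [labels, ends, List.count_cons]; omega)
  have hw' := hD.count_eq (x := w) (by simp [labels, ends, List.count_cons]; omega)
  simp only [labels, ends, List.flatMap_cons, List.flatMap_nil, List.count_append, List.count_cons,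
    List.count_nil, beq_iff_eq] at hu' hv' hw'
  -- These values are forced by the crossings after the move: `u` continues the overstrand from
  -- `m₂`, `w` the overstrand from `t₁`, and `v` is the reflection of `b₂` in `m₂`.
  let g : ℕ → A := fun x => if x = u then f m₂ else if x = v then f m₂ + f m₂ - f b₂
    else if x = w then f t₁ else f x
  have gu : g u = f m₂ := by simp [g]
  have gv : g v = f m₂ + f m₂ - f b₂ := by simp only [g]; grind
  have gw : g w = f t₁ := by simp only [g]; grind
  have go : ∀ x, x ≠ u → x ≠ v → x ≠ w → g x = f x := by
    intro x h1 h2 h3; simp [g, h1, h2, h3]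
  have e1 : g b₁ = f b₁ := go _ (by grind) (by grind) (by grind)
  have e2 : g b₂ = f b₂ := go _ (by grind) (by grind) (by grind)
  have e3 : g m₁ = f m₁ := go _ (by grind) (by grind) (by grind)
  have e4 : g m₂ = f m₂ := go _ (by grind) (by grind) (by grind)
  have e5 : g t₁ = f t₁ := go _ (by grind) (by grind) (by grind)
  have e6 : g t₂ = f t₂ := go _ (by grind) (by grind) (by grind)
  have k1 := hf (crossing b₁ m₁ v u) (by simp)
  have k2 := hf (crossing b₂ w v t₁) (by simp)
  have k3 := hf (crossing m₂ t₂ u w) (by simp)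
  simp only [IsColored] at k1 k2 k3
  refine Colorable.transfer (g := g) hf hne ?_ ?_ (a₀ := b₂) (by simp [labels, ends]) ?_
  · intro a ha
    exact go _ (by grind) (by grind) (by grind)
  · simp only [IsColoring, List.forall_mem_cons, IsColored, gu, gv, gw, e1, e2, e3, e4, e5, e6,
      List.not_mem_nil, IsEmpty.forall_iff, implies_true, and_true]
    clear_value g
    clear hne hf hD hu hv hw hu' hv' hw' go
    grind
  · simp only [labels, ends, List.flatMap_cons, List.flatMap_nil, List.append_nil,
      List.cons_append, List.nil_append, List.forall_mem_cons, gu, gv, gw, e1, e2, e3, e4, e5, e6,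
      List.not_mem_nil, IsEmpty.forall_iff, implies_true, and_true]
    clear_value g
    clear hne hf hD hu hv hw hu' hv' hw' go
    grind

theorem colorable_r3' {b₁ m₁ t₁ b₂ m₂ t₂ u v w : ℕ} {Γ : Diagram}
    (hD : IsClosed ([crossing b₁ u v m₁, crossing b₂ t₁ v w, crossing m₂ w u t₂] ++ Γ))
    (h : Colorable A ([crossing b₁ u v m₁, crossing b₂ t₁ v w, crossing m₂ w u t₂] ++ Γ)) :
    Colorable A ([crossing b₂ u v m₂, crossing b₁ t₂ v w, crossing m₁ w u t₁] ++ Γ) := by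
  obtain ⟨f, hf, hne⟩ := h
  have hu := hD.notMem (x := u) (by simp [labels, ends, List.count_cons]; omega)
  have hv := hD.notMem (x := v) (by simp [labels, ends, List.count_cons]; omega)
  have hw := hD.notMem (x := w) (by simp [labels, ends, List.count_cons]; omega)
  have hu' := hD.count_eq (x := u) (by simp [labels, ends, List.count_cons]; omega)
  have hv' := hD.count_eq (x := v) (by simp [labels, ends, List.count_cons]; omega)
  have hw' := hD.count_eq (x := w) (by simp [labels, ends, List.count_cons]; omega)
  simp only [labels, ends, List.flatMap_cons, List.flatMap_nil, List.count_append, List.count_cons,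
    List.count_nil, beq_iff_eq] at hu' hv' hw'
  let g : ℕ → A := fun x => if x = u then f m₂ else if x = v then f m₂ + f m₂ - f b₂
    else if x = w then f t₁ else f x
  have gu : g u = f m₂ := by simp [g]
  have gv : g v = f m₂ + f m₂ - f b₂ := by simp only [g]; grind
  have gw : g w = f t₁ := by simp only [g]; grind
  have go : ∀ x, x ≠ u → x ≠ v → x ≠ w → g x = f x := by
    intro x h1 h2 h3; simp [g, h1, h2, h3]
  have e1 : g b₁ = f b₁ := go _ (by grind) (by grind) (by grind)
  have e2 : g b₂ = f b₂ := go _ (by grind) (by grind) (by grind)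
  have e3 : g m₁ = f m₁ := go _ (by grind) (by grind) (by grind)
  have e4 : g m₂ = f m₂ := go _ (by grind) (by grind) (by grind)
  have e5 : g t₁ = f t₁ := go _ (by grind) (by grind) (by grind)
  have e6 : g t₂ = f t₂ := go _ (by grind) (by grind) (by grind)
  have k1 := hf (crossing b₁ u v m₁) (by simp)
  have k2 := hf (crossing b₂ t₁ v w) (by simp)
  have k3 := hf (crossing m₂ w u t₂) (by simp)
  simp only [IsColored] at k1 k2 k3
  refine Colorable.transfer (g := g) hf hne ?_ ?_ (a₀ := b₂) (by simp [labels, ends]) ?_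
  · intro a ha
    exact go _ (by grind) (by grind) (by grind)
  · simp only [IsColoring, List.forall_mem_cons, IsColored, gu, gv, gw, e1, e2, e3, e4, e5, e6,
      List.not_mem_nil, IsEmpty.forall_iff, implies_true, and_true]
    clear_value g
    clear hne hf hD hu hv hw hu' hv' hw' go
    grind
  · simp only [labels, ends, List.flatMap_cons, List.flatMap_nil, List.append_nil,
      List.cons_append, List.nil_append, List.forall_mem_cons, gu, gv, gw, e1, e2, e3, e4, e5, e6,
      List.not_mem_nil, IsEmpty.forall_iff, implies_true, and_true]
    clear_value g
    clear hne hf hD hu hv hw hu' hv' hw' go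
    grind

/-- The removal of the label `b` by a local change that forces it to have the colour of `a`. -/
theorem colorable_update_iff {L L' Γ : Diagram} (hD : IsClosed (L ++ Γ)) {a b : ℕ}
    (hb : 2 ≤ (labels L).count b) (ha : a ∈ labels L')
    (hcol : ∀ f : ℕ → A, IsColoring L f → IsColoring L' f)
    (hcol' : ∀ f : ℕ → A, IsColoring L' f → IsColoring L (Function.update f b (f a)))
    (hsub : ∀ x ∈ labels L, x = b ∨ x ∈ labels L') (hsub' : ∀ x ∈ labels L', x ∈ labels L)
    (hba : ∀ f : ℕ → A, IsColoring L f → f b = f a) (hbL' : b ∉ labels L') :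
    Colorable A (L ++ Γ) ↔ Colorable A (L' ++ Γ) := by
  constructor
  · rintro ⟨f, hf, hne⟩
    have hL : IsColoring L f := fun P hP => hf P (List.mem_append_left _ hP)
    refine Colorable.transfer hf hne (fun _ _ => rfl) (hcol f hL) ha fun h x hx => ?_
    rcases hsub x hx with rfl | hx
    · exact hba f hL
    · exact h x hx
  · rintro ⟨f, hf, hne⟩
    have hL : IsColoring L' f := fun P hP => hf P (List.mem_append_left _ hP)
    have hbΓ := hD.notMem hb
    have hab : a ≠ b := fun h => hbL' (h ▸ ha)
    refine Colorable.transfer hf hne (g := Function.update f b (f a)) (a₀ := a) ?_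
      (hcol' f hL) (hsub' a ha) fun h x hx => ?_
    · intro x hx
      exact Function.update_of_ne (fun h => hbΓ (by rwa [← h])) _ _
    · have := h x (hsub' x hx)
      rwa [Function.update_of_ne (fun h => hbL' (by rwa [← h]))] at this

end Diagram

end KnotMosaic

/-! ### Invariance of Fox colourability under Reidemeister moves -/

namespace KnotMosaic

namespace Diagram

variable {A : Type*} [AddCommGroup A]

open Piece

theorem Colorable.perm {D E : Diagram} (hp : D.Perm E) (h : Colorable A D) : Colorable A E := by
  obtain ⟨f, hf, a, ha, b, hb, hab⟩ := h
  exact ⟨f, fun P hP => hf P (hp.mem_iff.2 hP), a, (Perm.labels hp).mem_iff.1 ha, b,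
    (Perm.labels hp).mem_iff.1 hb, hab⟩

/-- Local changes that neither change the labels nor the condition on colourings. -/
theorem colorable_iff_of_labels {L L' Γ : Diagram} (hl : ∀ x, x ∈ labels L ↔ x ∈ labels L')
    (hc : ∀ f : ℕ → A, IsColoring L f ↔ IsColoring L' f) :
    Colorable A (L ++ Γ) ↔ Colorable A (L' ++ Γ) := by
  simp only [Colorable, labels_append, List.mem_append, hl]
  have : ∀ f : ℕ → A, IsColoring (L ++ Γ) f ↔ IsColoring (L' ++ Γ) f := fun f => by
    have := hc f
    simp only [IsColoring, List.forall_mem_append] at this ⊢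
    rw [this]
  simp only [this]

theorem colorable_r2_iff {p q r s m n : ℕ} {Γ : Diagram}
    (hD : IsClosed ([crossing r p m n, crossing m q s n] ++ Γ)) :
    Colorable A ([crossing r p m n, crossing m q s n] ++ Γ) ↔
      Colorable A ([arc p q, arc r s] ++ Γ) := by
  have hm := hD.notMem (x := m) (by simp [labels, ends, List.count_cons]; omega)
  have hn := hD.notMem (x := n) (by simp [labels, ends, List.count_cons]; omega)
  have hm' := hD.count_eq (x := m) (by simp [labels, ends, List.count_cons]; omega)
  have hn' := hD.count_eq (x := n) (by simp [labels, ends, List.count_cons]; omega)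
  simp only [labels, ends, List.flatMap_cons, List.flatMap_nil, List.count_append, List.count_cons,
    List.count_nil, beq_iff_eq] at hm' hn'
  constructor
  · rintro ⟨f, hf, hne⟩
    have k1 := hf (crossing r p m n) (by simp)
    have k2 := hf (crossing m q s n) (by simp)
    simp only [IsColored] at k1 k2
    refine Colorable.transfer hf hne (fun _ _ => rfl) ?_ (a₀ := p) (by simp [labels, ends]) ?_
    · simp only [IsColoring, List.forall_mem_cons, IsColored,
        List.not_mem_nil, IsEmpty.forall_iff, implies_true, and_true]
      clear hne hf hD hm hn hm' hn'
      grind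
    · simp only [labels, ends, List.flatMap_cons, List.flatMap_nil, List.append_nil,
        List.cons_append, List.nil_append, List.forall_mem_cons,
        List.not_mem_nil, IsEmpty.forall_iff, implies_true, and_true]
      clear hne hf hD hm hn hm' hn'
      grind
  · rintro ⟨f, hf, hne⟩
    have k1 := hf (arc p q) (by simp)
    have k2 := hf (arc r s) (by simp)
    simp only [IsColored] at k1 k2
    -- The bigon edge `n` lies on the overstrand from `p`; the edge `m` of the understrand is the
    -- reflection of `r` in `p`.
    let g : ℕ → A := fun x => if x = m then f p + f p - f r else if x = n then f p else f x
    have gm : g m = f p + f p - f r := by simp [g]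
    have gn : g n = f p := by simp only [g]; grind
    have go : ∀ x, x ≠ m → x ≠ n → g x = f x := by
      intro x h1 h2; simp [g, h1, h2]
    have e1 : g p = f p := go _ (by grind) (by grind)
    have e2 : g q = f q := go _ (by grind) (by grind)
    have e3 : g r = f r := go _ (by grind) (by grind)
    have e4 : g s = f s := go _ (by grind) (by grind)
    refine Colorable.transfer (g := g) hf hne ?_ ?_ (a₀ := p) (by simp [labels, ends]) ?_
    · intro a ha
      exact go _ (by grind) (by grind)
    · simp only [IsColoring, List.forall_mem_cons, IsColored, gm, gn, e1, e2, e3, e4,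
        List.not_mem_nil, IsEmpty.forall_iff, implies_true, and_true]
      clear_value g
      clear hne hf hD hm hn hm' hn' go
      grind
    · simp only [labels, ends, List.flatMap_cons, List.flatMap_nil, List.append_nil,
        List.cons_append, List.nil_append, List.forall_mem_cons, gm, gn, e1, e2, e3, e4,
        List.not_mem_nil, IsEmpty.forall_iff, implies_true, and_true]
      clear_value g
      clear hne hf hD hm hn hm' hn' go
      grind

/-- Elementary changes of a diagram preserve the existence of nonconstant Fox colourings. -/
theorem colorable_iff_of_step {D E : Diagram} (h : Step D E) : Colorable A D ↔ Colorable A E := by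
  obtain ⟨hD, hE, h⟩ := h
  have key : ∀ {L Γ : Diagram} {x : ℕ}, IsClosed (L ++ Γ) → 2 ≤ (labels L).count x →
      (labels L).count x = 2 := fun h hx => h.count_eq hx
  induction h with
  | perm h => exact ⟨Colorable.perm h, Colorable.perm h.symm⟩
  | arc_symm a b Γ =>
    refine colorable_iff_of_labels (L := [arc a b]) (L' := [arc b a]) ?_ ?_
    · intro x; simp [labels, ends, or_comm]
    · intro f; simp [IsColoring, IsColored, eq_comm]
  | crossing_symm a b c d Γ =>
    refine colorable_iff_of_labels (L := [crossing a b c d]) (L' := [crossing c d a b]) ?_ ?_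
    · intro x; simp [labels, ends]; tauto
    · intro f; simp [IsColoring, IsColored]; grind
  | arc_arc a b c Γ =>
    have h2 := key (L := [arc a b, arc b c]) (x := b) hD
      (by simp [labels, ends, List.count_cons]; omega)
    have hb : a ≠ b ∧ c ≠ b := by simp [labels, ends, List.count_cons] at h2; grind
    refine colorable_update_iff (L := [arc a b, arc b c]) (L' := [arc a c]) hD (a := a) (b := b)
      h2.ge ?_ ?_ ?_ ?_ ?_ ?_ ?_ <;>
    simp [labels, ends, IsColoring, IsColored, hb, hb.1.symm, hb.2.symm] <;> grind
  | crossing_arc a b c d e Γ =>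
    have h2 := key (L := [crossing a b c d, arc d e]) (x := d) hD
      (by simp [labels, ends, List.count_cons]; omega)
    have hb : a ≠ d ∧ b ≠ d ∧ c ≠ d ∧ e ≠ d := by simp [labels, ends, List.count_cons] at h2; grind
    refine colorable_update_iff (L := [crossing a b c d, arc d e]) (L' := [crossing a b c e]) hD
      (a := e) (b := d) h2.ge ?_ ?_ ?_ ?_ ?_ ?_ ?_ <;>
    simp [labels, ends, IsColoring, IsColored, hb, hb.1.symm, hb.2.1.symm, hb.2.2.1.symm,
      hb.2.2.2.symm] <;> grind
  | crossing_arc' a b c d e Γ =>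
    have h2 := key (L := [crossing a b c d, arc c e]) (x := c) hD
      (by simp [labels, ends, List.count_cons]; omega)
    have hb : a ≠ c ∧ b ≠ c ∧ d ≠ c ∧ e ≠ c := by simp [labels, ends, List.count_cons] at h2; grind
    refine colorable_update_iff (L := [crossing a b c d, arc c e]) (L' := [crossing a b e d]) hD
      (a := e) (b := c) h2.ge ?_ ?_ ?_ ?_ ?_ ?_ ?_ <;>
    simp [labels, ends, IsColoring, IsColored, hb, hb.1.symm, hb.2.1.symm, hb.2.2.1.symm,
      hb.2.2.2.symm] <;> grind
  | r1 a b c Γ =>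
    have h2 := key (L := [crossing a b b c]) (x := b) hD
      (by simp [labels, ends, List.count_cons]; omega)
    have hb : a ≠ b ∧ c ≠ b := by simp [labels, ends, List.count_cons] at h2; grind
    refine colorable_update_iff (L := [crossing a b b c]) (L' := [arc a c]) hD
      (a := a) (b := b) h2.ge ?_ ?_ ?_ ?_ ?_ ?_ ?_ <;>
    simp [labels, ends, IsColoring, IsColored, hb, hb.1.symm, hb.2.symm] <;> grind
  | r1' a b c Γ =>
    have h2 := key (L := [crossing b b a c]) (x := b) hD
      (by simp [labels, ends, List.count_cons])
    have hb : a ≠ b ∧ c ≠ b := by simp [labels, ends, List.count_cons] at h2; grind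
    refine colorable_update_iff (L := [crossing b b a c]) (L' := [arc a c]) hD
      (a := a) (b := b) h2.ge ?_ ?_ ?_ ?_ ?_ ?_ ?_ <;>
    simp [labels, ends, IsColoring, IsColored, hb, hb.1.symm, hb.2.symm] <;> grind
  | r2 p q r s m n Γ _ => exact colorable_r2_iff hD
  -- The inverse move is the same move with the indices 1 and 2 exchanged.
  | r3 b₁ m₁ t₁ b₂ m₂ t₂ u v w Γ => exact ⟨colorable_r3 hD, colorable_r3 hE⟩
  | r3' b₁ m₁ t₁ b₂ m₂ t₂ u v w Γ => exact ⟨colorable_r3' hD, colorable_r3' hE⟩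

theorem colorable_iff_of_linkType_eq {D E : Diagram} (h : D.linkType = E.linkType) :
    Colorable A D ↔ Colorable A E := by
  let φ : LinkType → Prop := Quot.lift (Colorable A) fun _ _ h => propext (colorable_iff_of_step h)
  exact iff_of_eq (congrArg φ h)

end Diagram

end KnotMosaic

namespace KnotMosaic

open Finset

/-! ### Flows modulo two on a square grid -/

/-- A flow modulo `2` on an `n × n` grid: `h i j` is its value at the top edge and `v i j` its value
at the left edge of the cell in row `i` and column `j`. It is even at every cell and vanishes on the
boundary and outside of the grid. -/
structure IsFlow (n : ℕ) (h v : ℕ → ℕ → ZMod 2) : Prop where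
  even : ∀ i j, h i j + h (i + 1) j + v i j + v i (j + 1) = 0
  h_out : ∀ i j, i = 0 ∨ n ≤ i ∨ n ≤ j → h i j = 0
  v_out : ∀ i j, j = 0 ∨ n ≤ i ∨ n ≤ j → v i j = 0

/-- The cell `(i, j)` meets the support of `(h, v)`. -/
def Occ (h v : ℕ → ℕ → ZMod 2) (i j : ℕ) : Prop :=
  h i j ≠ 0 ∨ h (i + 1) j ≠ 0 ∨ v i j ≠ 0 ∨ v i (j + 1) ≠ 0

instance (h v : ℕ → ℕ → ZMod 2) (i j : ℕ) : Decidable (Occ h v i j) :=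
  inferInstanceAs (Decidable (_ ∨ _))

/-- The flow passes through all four sides of the cell `(i, j)`. -/
def Full (h v : ℕ → ℕ → ZMod 2) (i j : ℕ) : Prop :=
  h i j = 1 ∧ h (i + 1) j = 1 ∧ v i j = 1 ∧ v i (j + 1) = 1

instance (h v : ℕ → ℕ → ZMod 2) (i j : ℕ) : Decidable (Full h v i j) :=
  inferInstanceAs (Decidable (_ ∧ _))

/-- The cells that meet the support. -/
def cells (n : ℕ) (h v : ℕ → ℕ → ZMod 2) : Finset (ℕ × ℕ) :=
  (range n ×ˢ range n).filter fun p => Occ h v p.1 p.2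

/-- The columns of the cells in row `i` that meet the support. -/
def row (n : ℕ) (h v : ℕ → ℕ → ZMod 2) (i : ℕ) : Finset ℕ :=
  (range n).filter fun j => Occ h v i j

theorem sum_add_succ_eq_zero {n : ℕ} (F : ℕ → ZMod 2) (h0 : F 0 = 0) (hn : F n = 0) :
    ∑ i ∈ range n, (F i + F (i + 1)) = 0 := by
  have : ∀ m, ∑ i ∈ range m, (F i + F (i + 1)) = F 0 + F m := by
    intro m
    induction m with
    | zero => simp [CharTwo.add_self_eq_zero]
    | succ m ih => rw [sum_range_succ, ih]; grind
  rw [this, h0, hn, add_zero]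

/-- Every inner edge borders two cells. -/
theorem sum_sum_edges_eq_zero {n : ℕ} (F G : ℕ → ℕ → ZMod 2)
    (hF : ∀ i j, i = 0 ∨ n ≤ i → F i j = 0) (hG : ∀ i j, j = 0 ∨ n ≤ j → G i j = 0) :
    ∑ i ∈ range n, ∑ j ∈ range n, ((F i j + F (i + 1) j) + (G i j + G i (j + 1))) = 0 := by
  simp only [sum_add_distrib (f := fun j => F _ j + F _ j)]
  rw [sum_add_distrib]
  have h1 : ∑ i ∈ range n, ∑ j ∈ range n, (F i j + F (i + 1) j) = 0 := by
    rw [sum_comm]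
    exact sum_eq_zero fun j _ => sum_add_succ_eq_zero (fun i => F i j) (hF 0 j (by simp))
      (hF n j (by simp))
  have h2 : ∑ i ∈ range n, ∑ j ∈ range n, (G i j + G i (j + 1)) = 0 :=
    sum_eq_zero fun i _ => sum_add_succ_eq_zero (fun j => G i j) (hG i 0 (by simp))
      (hG i n (by simp))
  rw [h1, h2, add_zero]

namespace IsFlow

variable {n : ℕ} {h v : ℕ → ℕ → ZMod 2}

theorem transpose (hf : IsFlow n h v) : IsFlow n (fun i j => v j i) (fun i j => h j i) where
  even i j := by have := hf.even j i; grind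
  h_out i j hij := hf.v_out j i (by tauto)
  v_out i j hij := hf.h_out j i (by tauto)

/-- By evenness of the cells between them, two consecutive lines differ by a sum in which each
vertical edge of the row occurs twice or lies on the boundary. The top line carries no flow. -/
theorem sum_line (hf : IsFlow n h v) (i : ℕ) : ∑ j ∈ range n, h i j = 0 := by
  induction i with
  | zero => exact sum_eq_zero fun j _ => hf.h_out 0 j (by simp)
  | succ i ih =>
    have h1 : ∀ j, h (i + 1) j = h i j + (v i j + v i (j + 1)) := fun j => by
      have := hf.even i j; grind
    simp only [h1, sum_add_distrib (f := fun j => h i j), ih, zero_add]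
    exact sum_add_succ_eq_zero _ (hf.v_out i 0 (by simp)) (hf.v_out i n (by simp))

/-- A horizontal line is passed an even number of times. -/
theorem exists_ne (hf : IsFlow n h v) {i j : ℕ} (hij : h i j ≠ 0) : ∃ k ≠ j, h i k ≠ 0 := by
  by_contra! hcon
  have hj : j < n := by
    by_contra! hj
    exact hij (hf.h_out i j (by simp [hj]))
  have := hf.sum_line i
  rw [sum_eq_single j (fun k _ hk => hcon k hk) (by simp [hj])] at this
  exact hij this

theorem lt_of_occ (hf : IsFlow n h v) {i j : ℕ} (ho : Occ h v i j) : i < n ∧ j < n := by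
  by_contra hcon
  have hcon : n ≤ i ∨ n ≤ j := by omega
  have h1 := hf.h_out i j (by omega)
  have h2 := hf.h_out (i + 1) j (by omega)
  have h3 := hf.v_out i j (by omega)
  have h4 := hf.v_out i (j + 1) (by omega)
  simp [Occ, h1, h2, h3, h4] at ho

theorem mem_cells (hf : IsFlow n h v) {p : ℕ × ℕ} : p ∈ cells n h v ↔ Occ h v p.1 p.2 := by
  simp only [cells, mem_filter, mem_product, mem_range, and_iff_right_iff_imp]
  exact fun ho => hf.lt_of_occ ho

theorem mem_row (hf : IsFlow n h v) {i j : ℕ} : j ∈ row n h v i ↔ Occ h v i j := by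
  simp only [row, mem_filter, mem_range, and_iff_right_iff_imp]
  exact fun ho => (hf.lt_of_occ ho).2

/-- All length estimates go through this inequality: it suffices to find distinct rows with many
cells. Estimates by columns follow by transposition. -/
theorem sum_card_row_le (hf : IsFlow n h v) (I : Finset ℕ) :
    ∑ i ∈ I, (row n h v i).card ≤ (cells n h v).card := by
  have h1 : (I.sigma fun i => row n h v i).card ≤ (cells n h v).card := by
    refine card_le_card_of_injOn (fun p => (p.1, p.2)) ?_ ?_
    · rintro ⟨i, j⟩ hp
      simp only [coe_sigma, Set.mem_sigma_iff, mem_coe, hf.mem_row, hf.mem_cells] at hp ⊢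
      exact hp.2
    · rintro ⟨i, j⟩ _ ⟨i', j'⟩ _ hp
      simpa using hp
  rwa [card_sigma] at h1

theorem card_cells_transpose (hf : IsFlow n h v) :
    (cells n (fun i j => v j i) (fun i j => h j i)).card = (cells n h v).card := by
  refine card_bij (fun p _ => p.swap) ?_ ?_ ?_
  · rintro ⟨i, j⟩ hp
    rw [hf.transpose.mem_cells] at hp
    rw [hf.mem_cells]
    simp only [Occ, Prod.swap] at hp ⊢
    tauto
  · rintro p _ q _ hpq
    exact Prod.swap_injective hpq
  · rintro ⟨i, j⟩ hp
    refine ⟨(j, i), ?_, rfl⟩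
    rw [hf.mem_cells] at hp
    rw [hf.transpose.mem_cells]
    simp only [Occ] at hp ⊢
    tauto

theorem two_le_row (hf : IsFlow n h v) {i j : ℕ} (hij : h i j ≠ 0 ∨ h (i + 1) j ≠ 0) :
    2 ≤ (row n h v i).card := by
  have : ∃ k ≠ j, h i k ≠ 0 ∨ h (i + 1) k ≠ 0 := by
    rcases hij with hij | hij
    · obtain ⟨k, hk, hk'⟩ := hf.exists_ne hij; exact ⟨k, hk, Or.inl hk'⟩
    · obtain ⟨k, hk, hk'⟩ := hf.exists_ne hij; exact ⟨k, hk, Or.inr hk'⟩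
  obtain ⟨k, hk, hk'⟩ := this
  refine one_lt_card.2 ⟨j, hf.mem_row.2 ?_, k, hf.mem_row.2 ?_, hk.symm⟩ <;>
  · unfold Occ; tauto

theorem card_le_row (hf : IsFlow n h v) {i : ℕ} (s : Finset ℕ) (hs : ∀ j ∈ s, Occ h v i j) :
    s.card ≤ (row n h v i).card :=
  card_le_card fun j hj => hf.mem_row.2 (hs j hj)

/-- The flow runs straight through the cell in horizontal direction. -/
theorem three_le_row (hf : IsFlow n h v) {i j : ℕ} (h1 : v i j ≠ 0) (h2 : v i (j + 1) ≠ 0) :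
    3 ≤ (row n h v i).card := by
  have hj : j ≠ 0 := fun hj => h1 (hf.v_out i j (by simp [hj]))
  obtain ⟨k, rfl⟩ := Nat.exists_eq_succ_of_ne_zero hj
  have := hf.card_le_row (i := i) {k, k + 1, k + 2} (by
    simp only [mem_insert, mem_singleton, forall_eq_or_imp, forall_eq]
    simp only [Nat.succ_eq_add_one] at h1 h2
    refine ⟨?_, ?_, ?_⟩ <;> unfold Occ <;> tauto)
  rwa [card_insert_of_notMem (by simp), card_insert_of_notMem (by simp), card_singleton] at this

/-- Two flows intersect transversally in an even number of cells. -/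
theorem sum_intersection (hf : IsFlow n h v) {k w : ℕ → ℕ → ZMod 2} (hg : IsFlow n k w) :
    ∑ i ∈ range n, ∑ j ∈ range n, (k (i + 1) j * v i j + w i (j + 1) * h i j) = 0 := by
  -- A potential of the first flow at the upper left corners of the cells: it changes by the value
  -- of each edge along which one moves, consistently because the flow is even. Weighting the edges
  -- of the second flow by it gives a sum that counts every inner edge twice.
  let g : ℕ → ℕ → ZMod 2 := fun i j => ∑ l ∈ range j, h i l
  have g1 : ∀ i j, g i (j + 1) = g i j + h i j := fun i j => sum_range_succ _ _
  have g2 : ∀ i j, g (i + 1) j = g i j + v i j := by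
    intro i j
    induction j with
    | zero => simp [g, hf.v_out i 0]
    | succ j ih => have := hf.even i j; rw [g1, g1, ih]; grind
  rw [← sum_sum_edges_eq_zero (n := n) (fun i j => k i j * g i j) (fun i j => w i j * g i j)
    (fun i j hij => by rw [hg.h_out i j (by tauto), zero_mul])
    (fun i j hij => by rw [hg.v_out i j (by tauto), zero_mul])]
  refine sum_congr rfl fun i _ => sum_congr rfl fun j _ => ?_
  -- With all weights moved to the corner `(i, j)`, what remains besides the intersection term is `g
  -- i j` times the even sum of `(k, w)` at the cell.
  rw [g1, g2]
  have := hg.even i j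
  linear_combination - g i j * this

end IsFlow

end KnotMosaic

/-! ### Lower bounds for the length of crossing flows -/

namespace KnotMosaic

open Finset

namespace IsFlow

variable {n : ℕ} {h v : ℕ → ℕ → ZMod 2}

theorem rows_of_vertical (hf : IsFlow n h v) {i j : ℕ} (h1 : h i j ≠ 0) (h2 : h (i + 1) j ≠ 0) :
    ∃ l, i = l + 1 ∧ 2 ≤ (row n h v l).card ∧ 2 ≤ (row n h v (l + 1)).card ∧
      2 ≤ (row n h v (l + 2)).card := by
  have hi : i ≠ 0 := fun hi => h1 (hf.h_out i j (by simp [hi]))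
  obtain ⟨l, rfl⟩ := Nat.exists_eq_succ_of_ne_zero hi
  exact ⟨l, rfl, hf.two_le_row (Or.inr h1), hf.two_le_row (Or.inl h1), hf.two_le_row (Or.inl h2)⟩

theorem six_le_of_vertical (hf : IsFlow n h v) {i j : ℕ} (h1 : h i j ≠ 0) (h2 : h (i + 1) j ≠ 0) :
    6 ≤ (cells n h v).card := by
  obtain ⟨l, rfl, r1, r2, r3⟩ := hf.rows_of_vertical h1 h2
  have := hf.sum_card_row_le {l, l + 1, l + 2}
  rw [sum_insert (by simp), sum_insert (by simp), sum_singleton] at this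
  omega

/-- The upper cell accounts for three consecutive rows of at least two cells, and the row below the
lower cell is a fourth one. -/
theorem eight_le_of_vertical (hf : IsFlow n h v) {i j i' j' : ℕ} (h1 : h i j ≠ 0)
    (h2 : h (i + 1) j ≠ 0) (h1' : h i' j' ≠ 0) (h2' : h (i' + 1) j' ≠ 0) (hne : i ≠ i') :
    8 ≤ (cells n h v).card := by
  wlog hlt : i < i' generalizing i j i' j'
  · exact this h1' h2' h1 h2 hne.symm (by omega)
  obtain ⟨l, rfl, r1, r2, r3⟩ := hf.rows_of_vertical h1 h2
  obtain ⟨m, rfl, -, -, r4⟩ := hf.rows_of_vertical h1' h2'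
  have := hf.sum_card_row_le {l, l + 1, l + 2, m + 2}
  rw [sum_insert (by simp; omega), sum_insert (by simp; omega), sum_insert (by simp; omega),
    sum_singleton] at this
  omega

/-- The vertical passage gives three rows with two cells each; the horizontal one either lengthens
one of them to three cells or lies in a further row. -/
theorem seven_le_of_vertical_horizontal (hf : IsFlow n h v) {i j i' j' : ℕ} (h1 : h i j ≠ 0)
    (h2 : h (i + 1) j ≠ 0) (h1' : v i' j' ≠ 0) (h2' : v i' (j' + 1) ≠ 0) :
    7 ≤ (cells n h v).card := by
  obtain ⟨l, rfl, r1, r2, r3⟩ := hf.rows_of_vertical h1 h2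
  have r4 := hf.three_le_row h1' h2'
  by_cases hi : i' = l ∨ i' = l + 1 ∨ i' = l + 2
  · have := hf.sum_card_row_le {l, l + 1, l + 2}
    rw [sum_insert (by simp), sum_insert (by simp), sum_singleton] at this
    rcases hi with rfl | rfl | rfl <;> omega
  · have := hf.sum_card_row_le {i', l, l + 1, l + 2}
    rw [sum_insert (by simpa using hi), sum_insert (by simp), sum_insert (by simp),
      sum_singleton] at this
    omega

end IsFlow

/-- At the cell `(i, j)` a flow with vertical edges `v` runs straight in horizontal direction, and a
flow with horizontal edges `k` runs straight in vertical direction. -/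
def Cross (v k : ℕ → ℕ → ZMod 2) (i j : ℕ) : Prop :=
  v i j ≠ 0 ∧ v i (j + 1) ≠ 0 ∧ k i j ≠ 0 ∧ k (i + 1) j ≠ 0

/-- Two flows that cross each other at two different cells are long. -/
theorem fourteen_le_of_cross {n : ℕ} {h v k w : ℕ → ℕ → ZMod 2} (hf : IsFlow n h v)
    (hg : IsFlow n k w) {i j i' j' : ℕ} (hne : (i, j) ≠ (i', j'))
    (h1 : Cross v k i j ∨ Cross w h i j)
    (h2 : Cross v k i' j' ∨ Cross w h i' j') :
    14 ≤ (cells n h v).card + (cells n k w).card := by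
  wlog h1' : Cross v k i j generalizing h v k w
  · have := this hg hf h1.symm h2.symm (h1.resolve_left h1')
    omega
  clear h1
  obtain ⟨a1, a2, a3, a4⟩ := h1'
  rcases h2 with ⟨b1, b2, b3, b4⟩ | ⟨b1, b2, b3, b4⟩
  -- The same flow is vertical at both cells. According to whether the cells differ in row or in
  -- column, the bounds are `8 + 6` or `6 + 8`.
  · by_cases hi : i = i'
    · have hj : j ≠ j' := fun hj => hne (by rw [hi, hj])
      have e1 := hg.six_le_of_vertical a3 a4
      have e2 := hf.transpose.eight_le_of_vertical a1 a2 b1 b2 hj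
      rw [hf.card_cells_transpose] at e2
      omega
    · have e1 := hg.eight_le_of_vertical a3 a4 b3 b4 hi
      have e2 := hf.transpose.six_le_of_vertical a1 a2
      rw [hf.card_cells_transpose] at e2
      omega
  -- The flows exchange their directions, so each runs straight once in either direction: `7 + 7`.
  · have e1 := hg.seven_le_of_vertical_horizontal a3 a4 b1 b2
    have e2 := hf.seven_le_of_vertical_horizontal b3 b4 a1 a2
    omega

/-! ### Full cells of a short flow -/

namespace IsFlow

variable {n : ℕ} {h v : ℕ → ℕ → ZMod 2}

theorem _root_.KnotMosaic.Full.transpose {i j : ℕ} (hx : Full h v i j) :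
    Full (fun i j => v j i) (fun i j => h j i) j i :=
  ⟨hx.2.2.1, hx.2.2.2, hx.1, hx.2.1⟩

theorem rows_of_full (hf : IsFlow n h v) {i j : ℕ} (hx : Full h v i j) :
    ∃ l, i = l + 1 ∧ 2 ≤ (row n h v l).card ∧ 3 ≤ (row n h v (l + 1)).card ∧
      2 ≤ (row n h v (l + 2)).card := by
  obtain ⟨h1, h2, h3, h4⟩ := hx
  obtain ⟨l, rfl, r1, -, r3⟩ := hf.rows_of_vertical (i := i) (j := j) (by simp [h1]) (by simp [h2])
  exact ⟨l, rfl, r1, hf.three_le_row (j := j) (by simp [h3]) (by simp [h4]), r3⟩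

/-- Each row of `R` has at least three cells. The rows just above the first and just below the last
row of `R` are outside `R` and have at least two cells each. -/
theorem card_rows_of_full_le (hf : IsFlow n h v) {R : Finset ℕ} (hR : R.Nonempty)
    (hfull : ∀ i ∈ R, ∃ j, Full h v i j) : 3 * R.card + 4 ≤ (cells n h v).card := by
  obtain ⟨j, hj⟩ := hfull _ (R.min'_mem hR)
  obtain ⟨j', hj'⟩ := hfull _ (R.max'_mem hR)
  obtain ⟨l, hl, r1, -, -⟩ := hf.rows_of_full hj
  obtain ⟨m, hm, -, -, r3⟩ := hf.rows_of_full hj'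
  have hle := R.min'_le_max' hR
  have e1 : l ∉ R := fun hl' => by have := R.min'_le l hl'; omega
  have e2 : m + 2 ∉ R := fun hm' => by have := R.le_max' _ hm'; omega
  have e3 : R.card • 3 ≤ ∑ i ∈ R, (row n h v i).card := by
    refine card_nsmul_le_sum _ _ _ fun i hi => ?_
    obtain ⟨j, hj⟩ := hfull i hi
    obtain ⟨p, rfl, -, r, -⟩ := hf.rows_of_full hj
    exact r
  have := hf.sum_card_row_le (insert l (insert (m + 2) R))
  rw [sum_insert (by simp [e1]; omega), sum_insert e2] at this
  simp only [smul_eq_mul] at e3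
  omega

theorem four_le_row_of_full (hf : IsFlow n h v) {i j j' : ℕ} (hx : Full h v i j)
    (hy : Full h v i j') (hne : j ≠ j') : 4 ≤ (row n h v i).card := by
  wlog hlt : j < j' generalizing j j'
  · exact this hy hx hne.symm (by omega)
  obtain ⟨l, rfl, -⟩ := hf.transpose.rows_of_full hx.transpose
  obtain ⟨h1, h2, h3, h4⟩ := hx
  obtain ⟨k1, k2, k3, k4⟩ := hy
  have := hf.card_le_row (i := i) {l, l + 1, j', j' + 1} (by
    simp only [mem_insert, mem_singleton, forall_eq_or_imp, forall_eq, Occ]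
    simp [h3, h4, k3, k4])
  rwa [card_insert_of_notMem (by simp; omega), card_insert_of_notMem (by simp; omega),
    card_insert_of_notMem (by simp), card_singleton] at this

/-- Row `i` has four cells, row `i'` three, both neighbours of row `i` two each, and so does the
neighbour of row `i'` on the side away from row `i`; the gap keeps these five rows distinct. -/
theorem twelve_le_of_far_corner (hf : IsFlow n h v) {i i' j j' : ℕ} (hx : Full h v i j)
    (hy : Full h v i j') (hz : Full h v i' j) (hj : j ≠ j') (hi : i + 2 ≤ i' ∨ i' + 2 ≤ i) :
    12 ≤ (cells n h v).card := by
  have r0 := hf.four_le_row_of_full hx hy hj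
  obtain ⟨l, rfl, r1, -, r3⟩ := hf.rows_of_full hx
  obtain ⟨m, rfl, s1, s2, s3⟩ := hf.rows_of_full hz
  rcases hi with hi | hi
  · have := hf.sum_card_row_le {l, l + 1, l + 2, m + 1, m + 2}
    rw [sum_insert (by simp; omega), sum_insert (by simp; omega), sum_insert (by simp; omega),
      sum_insert (by simp), sum_singleton] at this
    omega
  · have := hf.sum_card_row_le {m, m + 1, m + 2, l + 1, l + 2}
    rw [sum_insert (by simp; omega), sum_insert (by simp; omega), sum_insert (by simp; omega),
      sum_insert (by simp), sum_singleton] at this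
    omega

/-- The count of cells around three full cells that form an `L`. The rows `i₀, i, i', i₂` and the
columns `j₀, j, j', j₂` are consecutive in one or the other order. -/
theorem twelve_le_of_occ (hf : IsFlow n h v) {i₀ i i' i₂ j₀ j j' j₂ : ℕ}
    (hi : [i₀, i, i', i₂].Nodup) (hj : [j₀, j, j', j₂].Nodup)
    (o1 : Occ h v i₀ j) (o2 : Occ h v i₀ j') (r0 : 4 ≤ (row n h v i).card)
    (o3 : Occ h v i' j₀) (o4 : Occ h v i' j) (o5 : Occ h v i' j')
    (o6 : Occ h v i₂ j) (r2 : 2 ≤ (row n h v i₂).card)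
    (hz : ∃ z ≠ i, Occ h v z j' ∧ Occ h v z j₂) : 12 ≤ (cells n h v).card := by
  obtain ⟨z, hzi, z1, z2⟩ := hz
  simp only [List.nodup_cons, List.mem_cons, List.not_mem_nil, or_false, not_or, List.nodup_nil,
    not_false_eq_true, and_true] at hi hj
  have three : ∀ {l a b c}, Occ h v l a → Occ h v l b → Occ h v l c → a ≠ b → a ≠ c → b ≠ c →
      3 ≤ (row n h v l).card := by
    intro l a b c ha hb hc hab hac hbc
    have := hf.card_le_row (i := l) {a, b, c} (by simp [ha, hb, hc])
    rwa [card_eq_three.2 ⟨a, b, c, hab, hac, hbc, rfl⟩] at this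
  have r1 : 3 ≤ (row n h v i').card := three o3 o4 o5 (by tauto) (by tauto) (by tauto)
  have s0 : 2 ≤ (row n h v i₀).card := by
    have := hf.card_le_row (i := i₀) {j, j'} (by simp [o1, o2])
    rwa [card_pair (by tauto)] at this
  have key := hf.sum_card_row_le {i₀, i, i', i₂}
  -- So far the four rows give `2 + 4 + 3 + 2 = 11` cells. Wherever the row `z` lies, it contributes
  -- a twelfth one.
  rw [sum_insert (by simp; tauto), sum_insert (by simp; tauto), sum_insert (by simp; tauto),
    sum_singleton] at key
  by_cases h0 : z = i₀
  · subst h0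
    have := three o1 o2 z2 (by tauto) (by tauto) (by tauto)
    omega
  by_cases h1 : z = i'
  · subst h1
    have := hf.card_le_row (i := z) {j₀, j, j', j₂} (by simp [o3, o4, o5, z2])
    rw [card_insert_of_notMem (by simp; tauto), card_insert_of_notMem (by simp; tauto),
      card_pair (by tauto)] at this
    omega
  by_cases h2 : z = i₂
  · subst h2
    have := three o6 z1 z2 (by tauto) (by tauto) (by tauto)
    omega
  have s4 : 1 ≤ (row n h v z).card := card_pos.2 ⟨j', hf.mem_row.2 z1⟩
  have key := hf.sum_card_row_le {z, i₀, i, i', i₂}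
  rw [sum_insert (by simp; tauto), sum_insert (by simp; tauto), sum_insert (by simp; tauto),
    sum_insert (by simp; tauto), sum_singleton] at key
  omega

/-- A vertical line is also passed an even number of times, and a second passage occupies the cells
on both of its sides. -/
theorem exists_occ_right (hf : IsFlow n h v) {i j : ℕ} (hx : v i (j + 1) ≠ 0) :
    ∃ z ≠ i, Occ h v z j ∧ Occ h v z (j + 1) := by
  obtain ⟨z, hz, hz'⟩ := hf.transpose.exists_ne (i := j + 1) (j := i) hx
  exact ⟨z, hz, by unfold Occ; tauto, by unfold Occ; tauto⟩

theorem twelve_le_of_corner (hf : IsFlow n h v) {i i' j j' : ℕ} (hx : Full h v i j)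
    (hy : Full h v i j') (hz : Full h v i' j) (hi : i ≠ i') (hj : j ≠ j') :
    12 ≤ (cells n h v).card := by
  by_cases hi' : i + 2 ≤ i' ∨ i' + 2 ≤ i
  · exact hf.twelve_le_of_far_corner hx hy hz hj hi'
  by_cases hj' : j + 2 ≤ j' ∨ j' + 2 ≤ j
  · have := hf.transpose.twelve_le_of_far_corner hx.transpose hz.transpose hy.transpose hi hj'
    rwa [hf.card_cells_transpose] at this
  have r0 := hf.four_le_row_of_full hx hy hj
  obtain ⟨l, hl, -⟩ := hf.rows_of_full hx
  obtain ⟨m, hm, s1, -, s3⟩ := hf.rows_of_full hz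
  obtain ⟨p, hp, -⟩ := hf.transpose.rows_of_full hx.transpose
  obtain ⟨q, hq, -⟩ := hf.transpose.rows_of_full hy.transpose
  obtain ⟨x1, x2, x3, x4⟩ := hx
  obtain ⟨y1, y2, y3, y4⟩ := hy
  obtain ⟨z1, z2, z3, z4⟩ := hz
  subst hl hm hp hq
  -- The three cells now lie in a `2 × 2` square; the four cases are the orientations of the `L`,
  -- reduced to one count by reversing the lists of rows and columns.
  rcases (by omega : m = l + 1 ∨ l = m + 1) with rfl | rfl <;>
  rcases (by omega : q = p + 1 ∨ p = q + 1) with rfl | rfl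
  · exact hf.twelve_le_of_occ (i₀ := l) (i' := l + 2) (i₂ := l + 3) (j₀ := p) (j := p + 1)
      (j' := p + 2) (j₂ := p + 3) (by simp) (by simp) (by simp [Occ, *]) (by simp [Occ, *]) r0
      (by simp [Occ, *]) (by simp [Occ, *]) (by simp [Occ, *]) (by simp [Occ, *]) s3
      (hf.exists_occ_right (by simp [y4]))
  · obtain ⟨z, hz, o1, o2⟩ := hf.exists_occ_right (i := l + 1) (j := q) (by simp [y3])
    exact hf.twelve_le_of_occ (i₀ := l) (i' := l + 2) (i₂ := l + 3) (j₀ := q + 3) (j := q + 2)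
      (j' := q + 1) (j₂ := q) (by simp) (by simp) (by simp [Occ, *]) (by simp [Occ, *]) r0
      (by simp [Occ, *]) (by simp [Occ, *]) (by simp [Occ, *]) (by simp [Occ, *]) s3
      ⟨z, hz, o2, o1⟩
  · exact hf.twelve_le_of_occ (i₀ := m + 3) (i' := m + 1) (i₂ := m) (j₀ := p) (j := p + 1)
      (j' := p + 2) (j₂ := p + 3) (by simp; omega) (by simp) (by simp [Occ, *]) (by simp [Occ, *]) r0
      (by simp [Occ, *]) (by simp [Occ, *]) (by simp [Occ, *]) (by simp [Occ, *]) s1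
      (hf.exists_occ_right (by simp [y4]))
  · obtain ⟨z, hz, o1, o2⟩ := hf.exists_occ_right (i := m + 2) (j := q) (by simp [y3])
    exact hf.twelve_le_of_occ (i₀ := m + 3) (i' := m + 1) (i₂ := m) (j₀ := q + 3) (j := q + 2)
      (j' := q + 1) (j₂ := q) (by simp; omega) (by simp) (by simp [Occ, *]) (by simp [Occ, *]) r0
      (by simp [Occ, *]) (by simp [Occ, *]) (by simp [Occ, *]) (by simp [Occ, *]) s1
      ⟨z, hz, o2, o1⟩

/-- A flow that meets at most eleven cells has at most two full cells. -/
theorem card_full_le_two (hf : IsFlow n h v) (hN : (cells n h v).card ≤ 11) {s : Finset (ℕ × ℕ)}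
    (hs : ∀ p ∈ s, Full h v p.1 p.2) : s.card ≤ 2 := by
  by_contra! hcard
  have hne : s.Nonempty := card_pos.1 (by omega)
  -- Full cells in three rows would require `3 * 3 + 4 = 13` cells; likewise for columns. So three
  -- full cells would lie in two rows and two columns and form an `L`.
  have hR : (s.image Prod.fst).card ≤ 2 := by
    have := hf.card_rows_of_full_le (R := s.image Prod.fst) (hne.image _) (by
      intro i hi
      obtain ⟨p, hp, rfl⟩ := mem_image.1 hi
      exact ⟨_, hs p hp⟩)
    omega
  have hC : (s.image Prod.snd).card ≤ 2 := by
    have := hf.transpose.card_rows_of_full_le (R := s.image Prod.snd) (hne.image _) (by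
      intro i hi
      obtain ⟨p, hp, rfl⟩ := mem_image.1 hi
      exact ⟨_, (hs p hp).transpose⟩)
    rw [hf.card_cells_transpose] at this
    omega
  obtain ⟨⟨i, j⟩, hp, ⟨i', j'⟩, hq, hpq, hpq'⟩ :=
    exists_ne_map_eq_of_card_lt_of_maps_to (lt_of_le_of_lt hR hcard)
      (fun p hp => mem_image_of_mem Prod.fst hp)
  simp only at hpq'
  subst hpq'
  have hj : j ≠ j' := fun hj => hpq (by rw [hj])
  obtain ⟨⟨i', k⟩, hr, hr1, hr2⟩ : ∃ r ∈ s, r ≠ (i, j) ∧ r ≠ (i, j') := by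
    by_contra! hcon
    have : s ⊆ {(i, j), (i, j')} := fun r hr => by
      by_cases h : r = (i, j)
      · simp [h]
      · simp [hcon r hr h]
    have := (card_le_card this).trans card_le_two
    omega
  have hk : k = j ∨ k = j' := by
    by_contra! hk
    have : ({k, j, j'} : Finset ℕ) ⊆ s.image Prod.snd := by
      simp only [insert_subset_iff, singleton_subset_iff, mem_image]
      exact ⟨⟨_, hr, rfl⟩, ⟨_, hp, rfl⟩, ⟨_, hq, rfl⟩⟩
    have := card_le_card this
    rw [card_eq_three.2 ⟨k, j, j', hk.1, hk.2, hj, rfl⟩] at this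
    omega
  have hx := hs _ hp
  have hy := hs _ hq
  have hz := hs _ hr
  have : 12 ≤ (cells n h v).card := by
    rcases hk with rfl | rfl
    · exact hf.twelve_le_of_corner hx hy hz (fun h => hr1 (Prod.ext h.symm rfl)) hj
    · exact hf.twelve_le_of_corner hy hx hz (fun h => hr2 (Prod.ext h.symm rfl)) hj.symm
  omega

end IsFlow

end KnotMosaic

namespace KnotMosaic

open Finset Piece

/-! ### The flows on a mosaic -/

/-- The label of the midpoint of a side of a tile. -/
def midLabel (i j : ℕ) (s : Side) : ℕ := Nat.pair (midpoint i j s).1 (midpoint i j s).2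

theorem midLabel_bottom (i j : ℕ) : midLabel i j .bottom = midLabel (i + 1) j .top := by
  simp [midLabel, midpoint, mul_add]

theorem midLabel_right (i j : ℕ) : midLabel i j .right = midLabel i (j + 1) .left := by
  simp [midLabel, midpoint, mul_add]

namespace Mosaic

variable {n : ℕ} (M : Mosaic n)

/-- The tile in row `i` and column `j`, blank outside of the mosaic. -/
def tileAt (i j : ℕ) : Tile :=
  if h : i < n ∧ j < n then M.tile ⟨i, h.1⟩ ⟨j, h.2⟩ else .t0

theorem tileAt_fin (i j : Fin n) : M.tileAt i j = M.tile i j := by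
  simp [tileAt]

theorem lt_of_tileAt_ne {i j : ℕ} (h : M.tileAt i j ≠ .t0) : i < n ∧ j < n := by
  by_contra hcon
  exact h (dif_neg hcon)

theorem mem_diagram {P : Piece} :
    P ∈ M.diagram ↔ ∃ i j, P ∈ (M.tileAt i j).pieces (midLabel i j) := by
  simp only [diagram, List.mem_flatMap, List.mem_finRange, true_and]
  constructor
  · rintro ⟨i, j, hP⟩
    exact ⟨i, j, by rwa [tileAt_fin]⟩
  · rintro ⟨i, j, hP⟩
    have h : i < n ∧ j < n := M.lt_of_tileAt_ne fun h => by simp [h, Tile.pieces] at hP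
    refine ⟨⟨i, h.1⟩, ⟨j, h.2⟩, ?_⟩
    rwa [tileAt, dif_pos h] at hP

theorem exists_connection {i j : ℕ} {s : Side} (hs : s ∈ (M.tileAt i j).connections) :
    ∃ i' j' s', (i', j') ≠ (i, j) ∧ s' ∈ (M.tileAt i' j').connections ∧
      midpoint i' j' s' = midpoint i j s := by
  have h : i < n ∧ j < n := M.lt_of_tileAt_ne fun h => by simp [h, Tile.connections] at hs
  rw [tileAt, dif_pos h] at hs
  obtain ⟨i', j', hne, s', hs', he⟩ := M.suitablyConnected _ _ s hs
  refine ⟨i', j', s', fun h => hne ?_, by rwa [tileAt_fin], he⟩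
  simp only [Prod.mk.injEq] at h ⊢
  exact ⟨Fin.ext h.1, Fin.ext h.2⟩

/-- The parities of the coordinates tell on which kind of edge a midpoint lies, so only the tile
across the edge can share it. -/
theorem bottom_mem_iff {i j : ℕ} :
    .bottom ∈ (M.tileAt i j).connections ↔ .top ∈ (M.tileAt (i + 1) j).connections := by
  constructor <;> intro hs <;> obtain ⟨i', j', s', hne, hs', he⟩ := M.exists_connection hs <;>
    cases s' <;> simp only [midpoint, Prod.mk.injEq, ne_eq, not_and] at he hne
  · omega
  · omega
  · omega
  · rwa [show i' = i + 1 by omega, show j' = j by omega] at hs'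
  · omega
  · rwa [show i' = i by omega, show j' = j by omega] at hs'
  · omega
  · omega

theorem right_mem_iff {i j : ℕ} :
    .right ∈ (M.tileAt i j).connections ↔ .left ∈ (M.tileAt i (j + 1)).connections := by
  constructor <;> intro hs <;> obtain ⟨i', j', s', hne, hs', he⟩ := M.exists_connection hs <;>
    cases s' <;> simp only [midpoint, Prod.mk.injEq, ne_eq, not_and] at he hne
  · rwa [show i' = i by omega, show j' = j + 1 by omega] at hs'
  · omega
  · omega
  · omega
  · omega
  · omega
  · rwa [show i' = i by omega, show j' = j by omega] at hs'
  · omega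

theorem top_notMem_zero {j : ℕ} : .top ∉ (M.tileAt 0 j).connections := by
  intro hs
  obtain ⟨i', j', s', hne, hs', he⟩ := M.exists_connection hs
  cases s' <;> simp only [midpoint, Prod.mk.injEq, ne_eq, not_and] at he hne <;> omega

theorem left_notMem_zero {i : ℕ} : .left ∉ (M.tileAt i 0).connections := by
  intro hs
  obtain ⟨i', j', s', hne, hs', he⟩ := M.exists_connection hs
  cases s' <;> simp only [midpoint, Prod.mk.injEq, ne_eq, not_and] at he hne <;> omega

theorem tileAt_eq_of_le {i j : ℕ} (h : n ≤ i ∨ n ≤ j) : M.tileAt i j = .t0 :=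
  dif_neg (by omega)

/-- The values of a function on the labels at the connection points on top edges of tiles. -/
def hor (φ : ℕ → ZMod 2) (i j : ℕ) : ZMod 2 :=
  if .top ∈ (M.tileAt i j).connections then φ (midLabel i j .top) else 0

/-- The values of a function on the labels at the connection points on left edges of tiles. -/
def ver (φ : ℕ → ZMod 2) (i j : ℕ) : ZMod 2 :=
  if .left ∈ (M.tileAt i j).connections then φ (midLabel i j .left) else 0

variable (φ : ℕ → ZMod 2)

theorem hor_succ (i j : ℕ) : M.hor φ (i + 1) j =
    if .bottom ∈ (M.tileAt i j).connections then φ (midLabel i j .bottom) else 0 := by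
  simp only [hor, bottom_mem_iff, midLabel_bottom]

theorem ver_succ (i j : ℕ) : M.ver φ i (j + 1) =
    if .right ∈ (M.tileAt i j).connections then φ (midLabel i j .right) else 0 := by
  simp only [ver, right_mem_iff, midLabel_right]

theorem hor_out (i j : ℕ) (h : i = 0 ∨ n ≤ i ∨ n ≤ j) : M.hor φ i j = 0 := by
  rcases h with rfl | h
  · simp [hor, top_notMem_zero]
  · simp [hor, M.tileAt_eq_of_le h, Tile.connections]

theorem ver_out (i j : ℕ) (h : j = 0 ∨ n ≤ i ∨ n ≤ j) : M.ver φ i j = 0 := by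
  rcases h with rfl | h
  · simp [ver, left_notMem_zero]
  · simp [ver, M.tileAt_eq_of_le h, Tile.connections]

/-! ### Colourings of a mosaic as flows -/

variable {φ}

/-- Modulo 2 the crossing relation says that each strand keeps its colour, so the ends of colour 1
on a tile come in pairs. -/
theorem isFlow (hφ : M.diagram.IsColoring φ) : IsFlow n (M.hor φ) (M.ver φ) where
  even i j := by
    have hc : ∀ P ∈ (M.tileAt i j).pieces (midLabel i j), P.IsColored φ :=
      fun P hP => hφ P (M.mem_diagram.2 ⟨i, j, hP⟩)
    rw [hor_succ, ver_succ, hor, ver]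
    cases hT : M.tileAt i j <;>
      simp [hT, Tile.pieces, Tile.connections, IsColored] at hc ⊢ <;> grind
  h_out := M.hor_out φ
  v_out := M.ver_out φ

theorem isColoring_one : M.diagram.IsColoring (fun _ => (1 : ZMod 2)) := by
  intro P _
  cases P <;> simp [IsColored]

theorem isColoring_one_add (hφ : M.diagram.IsColoring φ) :
    M.diagram.IsColoring (fun x => 1 + φ x) := by
  intro P hP
  have := hφ P hP
  cases P <;> simp only [IsColored] at this ⊢ <;> grind

theorem occ_one_iff {i j : ℕ} :
    Occ (M.hor fun _ => 1) (M.ver fun _ => 1) i j ↔ M.tileAt i j ≠ .t0 := by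
  simp only [Occ, hor_succ, ver_succ]
  simp only [hor, ver]
  cases M.tileAt i j <;> simp [Tile.connections]

theorem card_cells_one :
    (cells n (M.hor fun _ => 1) (M.ver fun _ => 1)).card = M.tileNumber := by
  symm
  refine card_bij (fun p _ => ((p.1 : ℕ), (p.2 : ℕ))) ?_ ?_ ?_
  · rintro ⟨i, j⟩ hp
    rw [(M.isFlow M.isColoring_one).mem_cells, occ_one_iff, tileAt_fin]
    simpa using hp
  · rintro ⟨i, j⟩ _ ⟨i', j'⟩ _ h
    simp only [Prod.mk.injEq] at h ⊢
    exact ⟨Fin.ext h.1, Fin.ext h.2⟩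
  · rintro ⟨i, j⟩ hp
    rw [(M.isFlow M.isColoring_one).mem_cells, occ_one_iff] at hp
    obtain ⟨hi, hj⟩ := M.lt_of_tileAt_ne hp
    refine ⟨(⟨i, hi⟩, ⟨j, hj⟩), ?_, rfl⟩
    simpa [← tileAt_fin] using hp

theorem full_of_crossing {i j a b c d : ℕ}
    (h : crossing a b c d ∈ (M.tileAt i j).pieces (midLabel i j)) :
    Full (M.hor fun _ => 1) (M.ver fun _ => 1) i j := by
  simp only [Full, hor_succ, ver_succ]
  simp only [hor, ver]
  cases hT : M.tileAt i j <;> simp [hT, Tile.connections, Tile.pieces] at h ⊢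

theorem lt_of_crossing {i j a b c d : ℕ}
    (h : crossing a b c d ∈ (M.tileAt i j).pieces (midLabel i j)) : i < n ∧ j < n :=
  M.lt_of_tileAt_ne fun h0 => by simp [h0, Tile.pieces] at h

theorem crossing_unique {i j a b c d a' b' c' d' : ℕ}
    (h : crossing a b c d ∈ (M.tileAt i j).pieces (midLabel i j))
    (h' : crossing a' b' c' d' ∈ (M.tileAt i j).pieces (midLabel i j)) :
    crossing a b c d = crossing a' b' c' d' := by
  cases hT : M.tileAt i j <;> simp [hT, Tile.pieces] at h h' ⊢ <;> simp [h, h']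

theorem exists_ne_of_sum_eq_zero {F : ℕ → ℕ → ZMod 2}
    (h : ∑ i ∈ range n, ∑ j ∈ range n, F i j = 0) {i j : ℕ} (hi : i < n) (hj : j < n)
    (hF : F i j ≠ 0) : ∃ i' j', (i', j') ≠ (i, j) ∧ F i' j' ≠ 0 := by
  by_contra! hcon
  rw [← sum_product' (f := F), sum_eq_single (i, j) (fun p _ hp => hcon p.1 p.2 hp)
    (by simp [hi, hj])] at h
  exact hF h

/-- A tile with a single strand shows only one colour, so a tile with both colours has two strands
and all four connection points. -/
theorem full_of_occ_of_occ (hφ : M.diagram.IsColoring φ) {i j : ℕ}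
    (h : Occ (M.hor φ) (M.ver φ) i j)
    (h' : Occ (M.hor fun x => 1 + φ x) (M.ver fun x => 1 + φ x) i j) :
    Full (M.hor fun _ => 1) (M.ver fun _ => 1) i j := by
  have hc : ∀ P ∈ (M.tileAt i j).pieces (midLabel i j), P.IsColored φ :=
    fun P hP => hφ P (M.mem_diagram.2 ⟨i, j, hP⟩)
  have key : ∀ x : ZMod 2, 1 + x = 0 ∨ x = 0 := by decide
  have k1 := key (φ (midLabel i j .bottom))
  have k2 := key (φ (midLabel i j .top))
  simp only [Occ, Full, hor_succ, ver_succ] at h h' ⊢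
  simp only [hor, ver] at h h' ⊢
  cases hT : M.tileAt i j <;>
    simp [hT, Tile.pieces, Tile.connections, IsColored] at hc h h' ⊢ <;> grind only

/-- The local intersection term vanishes on all tiles without a crossing, including the two with two
arcs. On a crossing it is the sum of the colours of the two strands, hence nonzero only if they
differ. -/
theorem cross_of_intersection_ne (hφ : M.diagram.IsColoring φ) {i j : ℕ}
    (h : M.hor (fun x => 1 + φ x) (i + 1) j * M.ver φ i j +
      M.ver (fun x => 1 + φ x) i (j + 1) * M.hor φ i j ≠ 0) :
    Cross (M.ver φ) (M.hor fun x => 1 + φ x) i j ∨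
      Cross (M.ver fun x => 1 + φ x) (M.hor φ) i j := by
  have hc : ∀ P ∈ (M.tileAt i j).pieces (midLabel i j), P.IsColored φ :=
    fun P hP => hφ P (M.mem_diagram.2 ⟨i, j, hP⟩)
  have key : ∀ l b r t : ZMod 2, (1 + b) * l + (1 + r) * t ≠ 0 →
      (b = t ∧ l + r = b + t ∨ r = l ∧ b + t = r + l) →
      (l ≠ 0 ∧ r ≠ 0 ∧ 1 + t ≠ 0 ∧ 1 + b ≠ 0) ∨ (1 + l ≠ 0 ∧ 1 + r ≠ 0 ∧ t ≠ 0 ∧ b ≠ 0) := by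
    decide
  have key7 : ∀ l b r t : ZMod 2, (1 + b) * l + (1 + r) * t ≠ 0 → l = b → r = t → False := by
    decide
  have key8 : ∀ l b r t : ZMod 2, (1 + b) * l + (1 + r) * t ≠ 0 → t = l → b = r → False := by
    decide
  have key1 : ∀ x : ZMod 2, 1 + x = 0 ∨ x = 0 := by decide
  simp only [Cross, hor_succ, ver_succ] at h ⊢
  simp only [hor, ver] at h ⊢
  cases hT : M.tileAt i j <;>
    simp only [hT, Tile.pieces, IsColored, List.forall_mem_cons,
      List.not_mem_nil, IsEmpty.forall_iff, implies_true, and_true] at hc <;>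
    simp only [hT, Tile.connections, List.mem_cons,
      List.not_mem_nil, or_false, reduceCtorEq, or_true, if_true, if_false, or_self,
      zero_mul, mul_zero, add_zero, ne_eq, not_true_eq_false] at h ⊢
  · rw [hc] at h
    have := key1 (φ (midLabel i j .bottom))
    grind
  · rw [hc] at h
    have := key1 (φ (midLabel i j .top))
    grind
  · exact (key7 _ _ _ _ h hc.1 hc.2).elim
  · exact (key8 _ _ _ _ h hc.1 hc.2).elim
  · exact key _ _ _ _ h (Or.inl hc)
  · exact key _ _ _ _ h (Or.inr ⟨hc.1, hc.2⟩)

theorem intersection_ne_of_crossing (hφ : M.diagram.IsColoring φ) {i j a b c d : ℕ}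
    (h : crossing a b c d ∈ (M.tileAt i j).pieces (midLabel i j)) (hab : φ a ≠ φ b) :
    M.hor (fun x => 1 + φ x) (i + 1) j * M.ver φ i j +
      M.ver (fun x => 1 + φ x) i (j + 1) * M.hor φ i j ≠ 0 := by
  have hc := hφ _ (M.mem_diagram.2 ⟨i, j, h⟩)
  have key : ∀ l b r t : ZMod 2, l ≠ b → b = t → l + r = b + t → (1 + b) * l + (1 + r) * t ≠ 0 := by
    decide
  have key' : ∀ b r t l : ZMod 2, b ≠ r → r = l → b + t = r + l →
      (1 + b) * l + (1 + r) * t ≠ 0 := by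
    decide
  rw [hor_succ, ver_succ, hor, ver]
  cases hT : M.tileAt i j <;> simp only [hT, Tile.pieces, List.mem_cons, List.not_mem_nil, or_false,
    reduceCtorEq, or_self, Piece.crossing.injEq] at h
  · obtain ⟨rfl, rfl, rfl, rfl⟩ := h
    simpa [Tile.connections] using key _ _ _ _ hab hc.1 hc.2
  · obtain ⟨rfl, rfl, rfl, rfl⟩ := h
    simpa [Tile.connections] using key' _ _ _ _ hab hc.1 hc.2

/-- With at most eleven tiles, different components do not cross in an essential way. -/
theorem eq_of_crossing (hM : M.tileNumber ≤ 11) (hφ : M.diagram.IsColoring φ) {a b c d : ℕ}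
    (h : crossing a b c d ∈ M.diagram) : φ a = φ b := by
  by_contra hab
  obtain ⟨i, j, h⟩ := M.mem_diagram.1 h
  have h1 := M.isFlow M.isColoring_one
  have hf := M.isFlow hφ
  have hg := M.isFlow (M.isColoring_one_add hφ)
  have hx := M.intersection_ne_of_crossing hφ h hab
  obtain ⟨hi, hj⟩ := M.lt_of_crossing h
  obtain ⟨i', j', hne, hy⟩ := exists_ne_of_sum_eq_zero (hf.sum_intersection hg) hi hj hx
  have h14 := fourteen_le_of_cross hf hg hne.symm (M.cross_of_intersection_ne hφ hx)
    (M.cross_of_intersection_ne hφ hy)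
  -- Cells common to both flows are full, so there are at most two. The union then has at least `14
  -- - 2 = 12` cells, all of them nonblank tiles.
  rw [← card_union_add_card_inter] at h14
  have h2 := h1.card_full_le_two (by rwa [card_cells_one])
    (s := cells n (M.hor φ) (M.ver φ) ∩
      cells n (M.hor fun x => 1 + φ x) (M.ver fun x => 1 + φ x)) (by
      intro p hp
      rw [mem_inter, hf.mem_cells, hg.mem_cells] at hp
      exact M.full_of_occ_of_occ hφ hp.1 hp.2)
  have h3 : ∀ ψ : ℕ → ZMod 2, M.diagram.IsColoring ψ → cells n (M.hor ψ) (M.ver ψ) ⊆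
      cells n (M.hor fun _ => 1) (M.ver fun _ => 1) := by
    intro ψ hψ p hp
    rw [(M.isFlow hψ).mem_cells] at hp
    rw [h1.mem_cells]
    simp only [Occ, hor, ver] at hp ⊢
    grind
  have h4 := card_le_card (union_subset (h3 _ hφ) (h3 _ (M.isColoring_one_add hφ)))
  rw [card_cells_one] at h4
  omega

/-- All ends at a crossing have the same colour by `eq_of_crossing`, so any injection of the two
colours into another group gives a colouring. -/
theorem colorable_three_of_two (hM : M.tileNumber ≤ 11) (h : M.diagram.Colorable (ZMod 2)) :
    M.diagram.Colorable (ZMod 3) := by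
  obtain ⟨f, hf, a, ha, b, hb, hab⟩ := h
  have key : ∀ x y : ZMod 2, x ≠ y → (if x = 0 then 0 else 1 : ZMod 3) ≠ if y = 0 then 0 else 1 := by
    decide
  refine ⟨fun x => if f x = 0 then 0 else 1, fun P hP => ?_, a, ha, b, hb, key _ _ hab⟩
  have hc := hf P hP
  cases P with
  | arc a b => simp only [IsColored] at hc ⊢; rw [hc]
  | crossing a b c d =>
    have h1 := M.eq_of_crossing hM hf hP
    simp only [IsColored] at hc ⊢
    have h2 : f c = f d := by
      rw [h1] at hc
      exact add_left_cancel hc.2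
    simp only [h1, h2, hc.1, and_self]

/-- The cells at which the edges of one colour do not form an even set. -/
theorem exists_crossing_of_sum_ne {f : ℕ → ZMod 3} (hf : M.diagram.IsColoring f) (z : ZMod 3)
    {i j : ℕ} (h : (M.hor (fun x => if f x = z then 1 else 0) i j +
      M.hor (fun x => if f x = z then 1 else 0) (i + 1) j) +
      (M.ver (fun x => if f x = z then 1 else 0) i j +
      M.ver (fun x => if f x = z then 1 else 0) i (j + 1)) ≠ 0) :
    ∃ a b c d, crossing a b c d ∈ (M.tileAt i j).pieces (midLabel i j) ∧ f b ≠ z := by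
  have hc : ∀ P ∈ (M.tileAt i j).pieces (midLabel i j), P.IsColored f :=
    fun P hP => hf P (M.mem_diagram.2 ⟨i, j, hP⟩)
  have key : ∀ a b c d z : ZMod 3, b = d → a + c = b + d → b = z →
      (if a = z then 1 else 0 : ZMod 2) + (if b = z then 1 else 0) + (if c = z then 1 else 0) +
        (if d = z then 1 else 0) = 0 := by
    decide
  rw [hor_succ, ver_succ, hor, ver] at h
  cases hT : M.tileAt i j <;>
    simp [hT, Tile.pieces, Tile.connections, IsColored] at hc h ⊢
  all_goals first
    | (exfalso; grind)
    | skip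
  · intro hz
    refine h (Eq.trans ?_ (key _ _ _ _ z hc.1 hc.2 hz))
    ring
  · intro hz
    refine h (Eq.trans ?_ (key _ _ _ _ z hc.1 hc.2 hz))
    ring

/-- Such a crossing shows all three colours, that of the overstrand twice and the others once; a
colour `z` not on the overstrand thus occurs exactly once. -/
theorem sum_ne_of_crossing {f : ℕ → ZMod 3} (hf : M.diagram.IsColoring f) (z : ZMod 3)
    {i j a b c d : ℕ} (h : crossing a b c d ∈ (M.tileAt i j).pieces (midLabel i j))
    (hab : f a ≠ f b) (hb : f b ≠ z) : (M.hor (fun x => if f x = z then 1 else 0) i j +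
      M.hor (fun x => if f x = z then 1 else 0) (i + 1) j) +
      (M.ver (fun x => if f x = z then 1 else 0) i j +
      M.ver (fun x => if f x = z then 1 else 0) i (j + 1)) ≠ 0 := by
  have hc := hf _ (M.mem_diagram.2 ⟨i, j, h⟩)
  have key : ∀ a b c d z : ZMod 3, a ≠ b → b ≠ z → b = d → a + c = b + d →
      (if a = z then 1 else 0 : ZMod 2) + (if b = z then 1 else 0) + (if c = z then 1 else 0) +
        (if d = z then 1 else 0) ≠ 0 := by
    decide
  have hk := key _ _ _ _ z hab hb hc.1 hc.2
  rw [hor_succ, ver_succ, hor, ver]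
  cases hT : M.tileAt i j <;> simp only [hT, Tile.pieces, List.mem_cons, List.not_mem_nil, or_false,
    reduceCtorEq, or_self, Piece.crossing.injEq] at h
  · obtain ⟨rfl, rfl, rfl, rfl⟩ := h
    intro h0
    simp [Tile.connections] at h0
    refine hk (Eq.trans ?_ h0)
    ring
  · obtain ⟨rfl, rfl, rfl, rfl⟩ := h
    intro h0
    simp [Tile.connections] at h0
    refine hk (Eq.trans ?_ h0)
    ring

theorem colorable_two_of_three (hM : M.tileNumber ≤ 11) (h : M.diagram.Colorable (ZMod 3)) :
    M.diagram.Colorable (ZMod 2) := by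
  obtain ⟨f, hf, hne⟩ := h
  -- The colour `z` is that of the overstrand at some crossing with three colours, where its
  -- indicator is then even. If no such crossing exists, any colour for which the indicator is
  -- nonconstant will do.
  obtain ⟨z, ⟨a, ha, b, hb, haz, hbz⟩, hz⟩ : ∃ z,
      (∃ a ∈ M.diagram.labels, ∃ b ∈ M.diagram.labels, f a = z ∧ f b ≠ z) ∧
      ((∀ a b c d, crossing a b c d ∈ M.diagram → f a = f b) ∨
        ∃ i j a b c d, crossing a b c d ∈ (M.tileAt i j).pieces (midLabel i j) ∧ f b = z) := by
    by_cases hall : ∀ a b c d, crossing a b c d ∈ M.diagram → f a = f b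
    · obtain ⟨a, ha, b, hb, hab⟩ := hne
      exact ⟨f a, ⟨a, ha, b, hb, rfl, hab.symm⟩, Or.inl hall⟩
    · push Not at hall
      obtain ⟨a, b, c, d, hP, hab⟩ := hall
      obtain ⟨i, j, hP'⟩ := M.mem_diagram.1 hP
      exact ⟨f b, ⟨b, List.mem_flatMap.2 ⟨_, hP, by simp [ends]⟩, a,
        List.mem_flatMap.2 ⟨_, hP, by simp [ends]⟩, rfl, hab⟩, Or.inr ⟨i, j, a, b, c, d, hP', rfl⟩⟩
  refine ⟨fun x => if f x = z then 1 else 0, fun P hP => ?_, a, ha, b, hb, by simp [haz, hbz]⟩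
  have hc := hf P hP
  cases P with
  | arc a b => simp only [IsColored] at hc ⊢; rw [hc]
  | crossing a b c d =>
    simp only [IsColored] at hc ⊢
    by_cases hab : f a = f b
    · have h2 : f c = f d := by
        rw [hab] at hc
        exact add_left_cancel hc.2
      simp only [hab, h2, hc.1, and_self]
    by_cases hbz : f b = z
    · have key : ∀ a b c d z : ZMod 3, a ≠ b → b = z → b = d → a + c = b + d →
          ((if b = z then 1 else 0 : ZMod 2) = if d = z then 1 else 0) ∧
          ((if a = z then 1 else 0 : ZMod 2) + if c = z then 1 else 0) =
            (if b = z then 1 else 0) + if d = z then 1 else 0 := by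
        decide
      exact key _ _ _ _ z hab hbz hc.1 hc.2
    exfalso
    rcases hz with hz | ⟨i₀, j₀, a₀, b₀, c₀, d₀, h₀, hz⟩
    · exact hab (hz _ _ _ _ hP)
    obtain ⟨i, j, hP⟩ := M.mem_diagram.1 hP
    have hij := M.lt_of_crossing hP
    -- The parities of the indicator over all cells add up to zero, as every inner edge borders two
    -- cells. A crossing where it is odd therefore has a partner; both have overstrands of a colour
    -- other than `z`, so they differ from `(i₀, j₀)`.
    obtain ⟨i', j', hne', hy⟩ := exists_ne_of_sum_eq_zero
      (sum_sum_edges_eq_zero _ _ (fun i j h => M.hor_out _ i j (by tauto))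
        (fun i j h => M.ver_out _ i j (by tauto))) hij.1 hij.2
      (M.sum_ne_of_crossing hf z hP hab hbz)
    obtain ⟨a', b', c', d', hP', hb'⟩ := M.exists_crossing_of_sum_ne hf z hy
    have h1 : ((i, j) : ℕ × ℕ) ≠ (i₀, j₀) := by
      rintro h
      simp only [Prod.mk.injEq] at h
      obtain ⟨rfl, rfl⟩ := h
      have := M.crossing_unique hP h₀
      simp only [Piece.crossing.injEq] at this
      exact hbz (this.2.1 ▸ hz)
    have h2 : ((i', j') : ℕ × ℕ) ≠ (i₀, j₀) := by
      rintro h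
      simp only [Prod.mk.injEq] at h
      obtain ⟨rfl, rfl⟩ := h
      have := M.crossing_unique hP' h₀
      simp only [Piece.crossing.injEq] at this
      exact hb' (this.2.1 ▸ hz)
    have := (M.isFlow M.isColoring_one).card_full_le_two (by rwa [card_cells_one])
      (s := {(i', j'), (i, j), (i₀, j₀)}) (by
        simp only [mem_insert, mem_singleton, forall_eq_or_imp, forall_eq]
        exact ⟨M.full_of_crossing hP', M.full_of_crossing hP, M.full_of_crossing h₀⟩)
    rw [card_eq_three.2 ⟨_, _, _, hne', h2, h1, rfl⟩] at this
    omega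

end Mosaic

end KnotMosaic

namespace KnotMosaic

open Piece

/-! ### Rewriting of diagram codes -/

/-- The same piece, read from its opposite end. -/
def Piece.flip : Piece → Piece
  | .arc a b => .arc b a
  | .crossing a b c d => .crossing c d a b

/-- The same piece with other labels. -/
def Piece.relabel (σ : ℕ → ℕ) : Piece → Piece
  | .arc a b => .arc (σ a) (σ b)
  | .crossing a b c d => .crossing (σ a) (σ b) (σ c) (σ d)

namespace Diagram

theorem IsClosed.perm {D E : Diagram} (h : D.IsClosed) (hp : D.Perm E) : E.IsClosed :=
  h.of_labels_perm (Perm.labels hp)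

theorem IsClosed.of_count_eq {D E : Diagram} (h : D.IsClosed)
    (hc : ∀ x, D.labels.count x = E.labels.count x) : E.IsClosed :=
  h.of_labels_perm (List.perm_iff_count.2 hc)

theorem linkType_eq_of_perm {D E : Diagram} (h : D.IsClosed) (hp : D.Perm E) :
    D.linkType = E.linkType :=
  Quot.sound ⟨h, h.perm hp, .perm hp⟩

theorem IsClosed.flip {P : Piece} {Γ : Diagram} (h : IsClosed (P :: Γ)) :
    IsClosed (P.flip :: Γ) := by
  refine h.of_count_eq fun x => ?_
  cases P <;> simp [labels, ends, Piece.flip, List.count_cons] <;> ac_rfl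

theorem linkType_flip {P : Piece} {Γ : Diagram} (h : IsClosed (P :: Γ)) :
    linkType (P :: Γ) = linkType (P.flip :: Γ) := by
  refine Quot.sound ⟨h, h.flip, ?_⟩
  cases P with
  | arc a b => exact .arc_symm a b Γ
  | crossing a b c d => exact .crossing_symm a b c d Γ

/-- The label `a` is replaced by `b`. -/
def replace (a b : ℕ) (x : ℕ) : ℕ := if x = a then b else x

theorem relabel_replace_of_notMem {a b : ℕ} {P : Piece} (h : a ∉ P.ends) :
    P.relabel (replace a b) = P := by
  cases P <;> simp only [ends, List.mem_cons, List.not_mem_nil, or_false, not_or] at h <;>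
    simp only [relabel, replace] <;> grind

/-- Absorption of an arc by a neighbouring piece. -/
theorem linkType_absorb {a b : ℕ} {Q : Piece} {Γ : Diagram} (hab : a ≠ b)
    (hQ : Q.ends.count a = 1) (hD : IsClosed (arc a b :: Q :: Γ))
    (hE : IsClosed (Q.relabel (replace a b) :: Γ)) :
    linkType (arc a b :: Q :: Γ) = linkType (Q.relabel (replace a b) :: Γ) := by
  have swap : ∀ {P Q : Piece} {Γ : Diagram}, IsClosed (P :: Q :: Γ) →
      linkType (P :: Q :: Γ) = linkType (Q :: P :: Γ) :=
    fun h => linkType_eq_of_perm h (List.Perm.swap _ _ _)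
  have swapc : ∀ {P Q : Piece} {Γ : Diagram}, IsClosed (P :: Q :: Γ) → IsClosed (Q :: P :: Γ) :=
    fun h => h.perm (List.Perm.swap _ _ _)
  rw [swap hD]
  have hD := swapc hD
  rcases Q with ⟨x, y⟩ | ⟨x, y, z, w⟩
  · simp only [ends, List.count_cons, List.count_nil, beq_iff_eq] at hQ
    by_cases hy : y = a
    · have hx : x ≠ a := by grind
      subst hy
      simp only [relabel, replace, hx, if_true, if_false] at hE ⊢
      exact Quot.sound ⟨hD, hE, .arc_arc x y b Γ⟩
    · have hx : x = a := by grind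
      subst hx
      simp only [relabel, replace, hy, if_true, if_false] at hE ⊢
      rw [linkType_flip hD, linkType_flip hE]
      exact Quot.sound ⟨hD.flip, hE.flip, .arc_arc y x b Γ⟩
  · simp only [ends, List.count_cons, List.count_nil, beq_iff_eq] at hQ
    by_cases hw : w = a
    · have h : x ≠ a ∧ y ≠ a ∧ z ≠ a := by grind
      subst hw
      simp only [relabel, replace, h, if_true, if_false] at hE ⊢
      exact Quot.sound ⟨hD, hE, .crossing_arc x y z w b Γ⟩
    by_cases hz : z = a
    · have h : x ≠ a ∧ y ≠ a := by grind
      subst hz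
      simp only [relabel, replace, h, hw, if_true, if_false] at hE ⊢
      exact Quot.sound ⟨hD, hE, .crossing_arc' x y z w b Γ⟩
    -- The moves absorb arcs only at the third and fourth ends of a crossing; reading it from the
    -- opposite end brings the first two there.
    rw [linkType_flip hD, linkType_flip hE]
    by_cases hy : y = a
    · have h : x ≠ a := by grind
      subst hy
      simp only [relabel, replace, h, hz, hw, if_true, if_false] at hE ⊢
      exact Quot.sound ⟨hD.flip, hE.flip, .crossing_arc z w x y b Γ⟩
    · have h : x = a := by grind
      subst h
      simp only [relabel, replace, hy, hz, hw, if_true, if_false] at hE ⊢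
      exact Quot.sound ⟨hD.flip, hE.flip, .crossing_arc' z w x y b Γ⟩

/-- Elementary rewriting steps: the contraction of the arc from `a` to `b`, and the reversal of a
piece. -/
inductive Op where
  | contract (a b : ℕ)
  | flip (P : Piece)

/-- The step can be applied. -/
def Op.Valid (D : Diagram) : Op → Prop
  | .contract a b => arc a b ∈ D ∧ a ≠ b
  | .flip P => P ∈ D

instance (D : Diagram) (o : Op) : Decidable (o.Valid D) := by
  cases o <;> unfold Op.Valid <;> infer_instance

/-- The result of the step. -/
def Op.apply (D : Diagram) : Op → Diagram
  | .contract a b => (D.erase (arc a b)).map (Piece.relabel (replace a b))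
  | .flip P => P.flip :: D.erase P

instance (D : Diagram) : Decidable D.IsClosed := by
  unfold IsClosed; infer_instance

/-- The given sequence of steps leads from `D` to `E`, through closed diagrams. -/
def Rewrites : List Op → Diagram → Diagram → Prop
  | [], D, E => D.IsClosed ∧ D.Perm E
  | o :: l, D, E => D.IsClosed ∧ o.Valid D ∧ Rewrites l (o.apply D) E

instance decidableRewrites : (l : List Op) → (D E : Diagram) → Decidable (Rewrites l D E)
  | [], D, E => inferInstanceAs (Decidable (D.IsClosed ∧ D.Perm E))
  | o :: l, D, E =>
    have := decidableRewrites l (o.apply D) E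
    inferInstanceAs (Decidable (D.IsClosed ∧ o.Valid D ∧ Rewrites l (o.apply D) E))

theorem linkType_apply {D : Diagram} {o : Op} (hD : D.IsClosed) (ho : o.Valid D)
    (hE : (o.apply D).IsClosed) : D.linkType = (o.apply D).linkType := by
  cases o with
  | flip P =>
    have hp := List.perm_cons_erase ho
    exact (linkType_eq_of_perm hD hp).trans (linkType_flip (hD.perm hp))
  | contract a b =>
    obtain ⟨hmem, hab⟩ := ho
    have hp := List.perm_cons_erase hmem
    rw [linkType_eq_of_perm hD hp]
    replace hD := hD.perm hp
    simp only [Op.apply] at hE ⊢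
    generalize D.erase (arc a b) = Γ at hD hE ⊢
    have ha := hD a (by simp [labels, ends])
    -- Besides the contracted arc, `a` labels a single end, in a piece `Q`. Relabelling all of `Γ`
    -- thus changes only `Q`, which absorbs the arc.
    have ha1 : (labels Γ).count a = 1 := by
      simp [labels, ends, hab.symm] at ha
      exact ha
    obtain ⟨Q, hQ, haQ⟩ := List.mem_flatMap.1 (List.count_pos_iff.1 (by omega : 0 < (labels Γ).count a))
    have hq := List.perm_cons_erase hQ
    have h2 := (Perm.labels hq).count_eq a
    rw [ha1, labels, List.flatMap_cons, List.count_append] at h2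
    have h3 := List.count_pos_iff.2 haQ
    have h4 : a ∉ labels (Γ.erase Q) := by
      rw [← List.count_pos_iff, labels]
      omega
    have h5 : (Γ.erase Q).map (Piece.relabel (replace a b)) = Γ.erase Q := by
      conv_rhs => rw [← List.map_id (Γ.erase Q)]
      exact List.map_congr_left fun P hP =>
        relabel_replace_of_notMem fun haP => h4 (List.mem_flatMap.2 ⟨P, hP, haP⟩)
    have hq' := hq.map (Piece.relabel (replace a b))
    rw [List.map_cons, h5] at hq'
    rw [linkType_eq_of_perm hD (hq.cons _), linkType_eq_of_perm hE hq']
    exact linkType_absorb hab (by omega) (hD.perm (hq.cons _)) (hE.perm hq')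

theorem Rewrites.isClosed {l : List Op} {D E : Diagram} (h : Rewrites l D E) : D.IsClosed := by
  cases l with
  | nil => exact h.1
  | cons o l => exact h.1

theorem Rewrites.linkType_eq {l : List Op} {D E : Diagram} (h : Rewrites l D E) :
    D.linkType = E.linkType := by
  induction l generalizing D with
  | nil => exact linkType_eq_of_perm h.1 h.2
  | cons o l ih =>
    obtain ⟨h1, h2, h3⟩ := h
    exact (linkType_apply h1 h2 h3.isClosed).trans (ih h3)

end Diagram

end KnotMosaic

namespace KnotMosaic

open Piece Diagram

/-! ### Mosaics with twelve tiles -/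

/-- The tiles of a `4 × 4` array with blank corners and four given tiles in the centre. -/
def ringTile (X Y Z W : Tile) : Fin 4 → Fin 4 → Tile :=
  ![![.t0, .t2, .t1, .t0], ![.t2, X, Y, .t1], ![.t3, Z, W, .t4], ![.t0, .t3, .t4, .t0]]

/-- The opposite side. -/
def Side.opposite : Side → Side
  | .left => .right
  | .bottom => .top
  | .right => .left
  | .top => .bottom

/-- The position behind a side of a tile in a `4 × 4` array, whose opposite sides are identified. -/
def neighbour (i j : Fin 4) : Side → Fin 4 × Fin 4
  | .left => (i, j - 1)
  | .bottom => (i + 1, j)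
  | .right => (i, j + 1)
  | .top => (i - 1, j)

/-- The `4`-mosaic whose four central tiles have four connection points. -/
def ringMosaic (X Y Z W : Tile) (hX : X.connections = [.left, .bottom, .right, .top])
    (hY : Y.connections = [.left, .bottom, .right, .top])
    (hZ : Z.connections = [.left, .bottom, .right, .top])
    (hW : W.connections = [.left, .bottom, .right, .top]) : Mosaic 4 where
  tile := ringTile X Y Z W
  suitablyConnected i j s hs := by
    -- Connectedness depends only on the connection points, so one concrete choice of central tiles
    -- can be checked by computation.
    have h : ∀ i j, (ringTile X Y Z W i j).connections =
        (ringTile .t9 .t9 .t9 .t9 i j).connections := by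
      have h9 : Tile.t9.connections = [.left, .bottom, .right, .top] := rfl
      simp [Fin.forall_fin_succ, ringTile, h9, hX, hY, hZ, hW]
    rw [h] at hs
    have h' : ∀ i j, ∀ s ∈ (ringTile .t9 .t9 .t9 .t9 i j).connections,
        neighbour i j s ≠ (i, j) ∧
        s.opposite ∈ (ringTile .t9 .t9 .t9 .t9 (neighbour i j s).1 (neighbour i j s).2).connections ∧
        midpoint (neighbour i j s).1 (neighbour i j s).2 s.opposite = midpoint i j s := by
      decide
    obtain ⟨h1, h2, h3⟩ := h' i j s hs
    exact ⟨_, _, h1, _, by rwa [h], h3⟩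

theorem tileNumber_ringMosaic {X Y Z W : Tile} (hX hY hZ hW) :
    (ringMosaic X Y Z W hX hY hZ hW).tileNumber = 12 := by
  have h : ∀ T : Tile, T.connections = [.left, .bottom, .right, .top] → T ≠ .t0 := by
    rintro T hT rfl
    simp [Tile.connections] at hT
  simp [Mosaic.tileNumber, ringMosaic, Finset.card_filter, Fintype.sum_prod_type,
    Fin.sum_univ_four, ringTile, h _ hX, h _ hY, h _ hZ, h _ hW]

/-- Contraction only removes arcs, so two codes with different labels are compared through a common
refinement `E`. In the applications, `E` is the mosaic diagram with extra arcs joining labels of the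
standard code to labels of midpoints: contracting them one way restores the mosaic, and contracting
the other way, along with the mosaic's own arcs, leaves the standard code. -/
theorem linkType_eq_of_rewrites {D E F : Diagram} (l m : List Op) (h : Rewrites l E D)
    (h' : Rewrites m E F) : D.linkType = F.linkType :=
  h.linkType_eq.symm.trans h'.linkType_eq

theorem linkType_ringMosaic_trefoil :
    (ringMosaic .t8 .t10 .t10 .t9 rfl rfl rfl rfl).diagram.linkType = trefoil.linkType :=
  linkType_eq_of_rewrites
    (E := [arc 0 29, arc 1 39, arc 3 27, arc 2 19, arc 5 45, arc 4 34, arc 11 17, arc 17 27, arc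
      21 14, arc 11 14, arc 23 19, crossing 0 1 3 2, arc 39 53, arc 32 21, crossing 5 4 23 32,
      crossing 34 47 41 29, arc 53 41, arc 60 45, arc 47 60])
    [.contract 0 29, .contract 1 39, .contract 3 27, .contract 2 19, .contract 5 45, .contract 4
      34]
    [.flip (arc 0 29), .contract 29 0, .flip (arc 1 39), .contract 39 1, .flip (arc 1 53),
      .contract 53 1, .flip (arc 1 41), .contract 41 1, .flip (arc 3 27), .contract 27 3,
      .contract 17 3, .contract 11 3, .flip (arc 3 14), .contract 14 3, .contract 21 3, .contract
      32 3, .flip (arc 2 19), .contract 19 2, .contract 23 2, .flip (arc 5 45), .contract 45 5,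
      .contract 60 5, .contract 47 5, .flip (arc 4 34), .contract 34 4, .flip (crossing 5 4 2 3)]
    (by decide) (by decide)

theorem linkType_ringMosaic_trefoil_mirror :
    (ringMosaic .t8 .t9 .t9 .t10 rfl rfl rfl rfl).diagram.linkType = trefoil.mirror.linkType :=
  linkType_eq_of_rewrites
    (E := [arc 2 19, arc 0 29, arc 1 39, arc 3 27, arc 5 45, arc 4 34, arc 11 17, arc 17 27, arc
      21 14, arc 11 14, arc 23 19, crossing 2 0 1 3, arc 39 53, arc 32 21, crossing 32 5 4 23,
      crossing 47 41 29 34, arc 53 41, arc 60 45, arc 47 60])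
    [.contract 2 19, .contract 0 29, .contract 1 39, .contract 3 27, .contract 5 45, .contract 4
      34]
    [.flip (arc 2 19), .contract 19 2, .contract 23 2, .flip (arc 0 29), .contract 29 0, .flip
      (arc 1 39), .contract 39 1, .flip (arc 1 53), .contract 53 1, .flip (arc 1 41), .contract 41
      1, .flip (arc 3 27), .contract 27 3, .contract 17 3, .contract 11 3, .flip (arc 3 14),
      .contract 14 3, .contract 21 3, .contract 32 3, .flip (arc 5 45), .contract 45 5, .contract
      60 5, .contract 47 5, .flip (arc 4 34), .contract 34 4, .flip (crossing 2 0 1 3)]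
    (by decide) (by decide)

theorem linkType_ringMosaic_hopfLink :
    (ringMosaic .t8 .t9 .t9 .t8 rfl rfl rfl rfl).diagram.linkType = hopfLink.linkType :=
  linkType_eq_of_rewrites
    (E := [arc 0 19, arc 1 29, arc 3 39, arc 2 27, arc 11 17, arc 17 27, arc 21 14, arc 11 14, arc
      23 19, crossing 0 1 3 2, arc 39 53, arc 32 21, crossing 32 45 34 23, arc 29 34, arc 47 41,
      arc 53 41, arc 60 45, arc 47 60])
    [.contract 0 19, .contract 1 29, .contract 3 39, .contract 2 27]
    [.flip (arc 0 19), .contract 19 0, .contract 23 0, .flip (arc 1 29), .contract 29 1, .flip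
      (arc 1 34), .contract 34 1, .flip (arc 3 39), .contract 39 3, .flip (arc 3 53), .contract 53
      3, .flip (arc 3 41), .contract 41 3, .contract 47 3, .flip (arc 3 60), .contract 60 3, .flip
      (arc 3 45), .contract 45 3, .flip (arc 2 27), .contract 27 2, .contract 17 2, .contract 11
      2, .flip (arc 2 14), .contract 14 2, .contract 21 2, .contract 32 2]
    (by decide) (by decide)

theorem linkType_ringMosaic_hopfLink_mirror :
    (ringMosaic .t8 .t10 .t10 .t8 rfl rfl rfl rfl).diagram.linkType = hopfLink.mirror.linkType :=
  linkType_eq_of_rewrites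
    (E := [arc 1 29, arc 3 39, arc 2 27, arc 0 19, arc 11 17, arc 17 27, arc 21 14, arc 11 14, arc
      23 19, crossing 1 3 2 0, arc 39 53, arc 32 21, crossing 45 34 23 32, arc 29 34, arc 47 41,
      arc 53 41, arc 60 45, arc 47 60])
    [.contract 1 29, .contract 3 39, .contract 2 27, .contract 0 19]
    [.flip (arc 1 29), .contract 29 1, .flip (arc 1 34), .contract 34 1, .flip (arc 3 39),
      .contract 39 3, .flip (arc 3 53), .contract 53 3, .flip (arc 3 41), .contract 41 3,
      .contract 47 3, .flip (arc 3 60), .contract 60 3, .flip (arc 3 45), .contract 45 3, .flip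
      (arc 2 27), .contract 27 2, .contract 17 2, .contract 11 2, .flip (arc 2 14), .contract 14
      2, .contract 21 2, .contract 32 2, .flip (arc 0 19), .contract 19 0, .contract 23 0]
    (by decide) (by decide)

theorem linkType_ringMosaic_solomonKnot :
    (ringMosaic .t9 .t10 .t10 .t9 rfl rfl rfl rfl).diagram.linkType = solomonKnot.linkType :=
  linkType_eq_of_rewrites
    (E := [arc 0 14, arc 1 23, arc 3 19, arc 2 11, arc 5 29, arc 4 39, arc 6 45, arc 7 34, arc 11
      17, arc 17 27, arc 21 14, crossing 0 1 3 2, crossing 5 4 27 19, arc 39 53, arc 32 21,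
      crossing 6 7 23 32, crossing 34 47 41 29, arc 53 41, arc 60 45, arc 47 60])
    [.contract 0 14, .contract 1 23, .contract 3 19, .contract 2 11, .contract 5 29, .contract 4
      39, .contract 6 45, .contract 7 34]
    [.flip (arc 0 14), .contract 14 0, .contract 21 0, .contract 32 0, .flip (arc 1 23), .contract
      23 1, .flip (arc 3 19), .contract 19 3, .flip (arc 2 11), .contract 11 2, .flip (arc 2 17),
      .contract 17 2, .flip (arc 2 27), .contract 27 2, .flip (arc 5 29), .contract 29 5, .flip
      (arc 4 39), .contract 39 4, .flip (arc 4 53), .contract 53 4, .flip (arc 4 41), .contract 41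
      4, .flip (arc 6 45), .contract 45 6, .contract 60 6, .contract 47 6, .flip (arc 7 34),
      .contract 34 7, .flip (crossing 5 4 2 3), .flip (crossing 7 6 4 5)]
    (by decide) (by decide)

theorem linkType_ringMosaic_solomonKnot_mirror :
    (ringMosaic .t10 .t9 .t9 .t10 rfl rfl rfl rfl).diagram.linkType = solomonKnot.mirror.linkType :=
  linkType_eq_of_rewrites
    (E := [arc 1 23, arc 3 19, arc 2 11, arc 0 14, arc 5 29, arc 4 39, arc 6 45, arc 7 34, arc 11
      17, arc 17 27, arc 21 14, crossing 1 3 2 0, crossing 19 5 4 27, arc 39 53, arc 32 21,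
      crossing 32 6 7 23, crossing 47 41 29 34, arc 53 41, arc 60 45, arc 47 60])
    [.contract 1 23, .contract 3 19, .contract 2 11, .contract 0 14, .contract 5 29, .contract 4
      39, .contract 6 45, .contract 7 34]
    [.flip (arc 1 23), .contract 23 1, .flip (arc 3 19), .contract 19 3, .flip (arc 2 11),
      .contract 11 2, .flip (arc 2 17), .contract 17 2, .flip (arc 2 27), .contract 27 2, .flip
      (arc 0 14), .contract 14 0, .contract 21 0, .contract 32 0, .flip (arc 5 29), .contract 29
      5, .flip (arc 4 39), .contract 39 4, .flip (arc 4 53), .contract 53 4, .flip (arc 4 41),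
      .contract 41 4, .flip (arc 6 45), .contract 45 6, .contract 60 6, .contract 47 6, .flip (arc
      7 34), .contract 34 7, .flip (crossing 0 6 7 1), .flip (crossing 6 4 5 7)]
    (by decide) (by decide)

end KnotMosaic

namespace KnotMosaic

open Piece Diagram

/-! ### Colourings of the standard diagrams -/

instance {A : Type*} [AddCommGroup A] [DecidableEq A] (f : ℕ → A) (P : Piece) :
    Decidable (P.IsColored f) := by
  cases P <;> unfold Piece.IsColored <;> infer_instance

instance {A : Type*} [AddCommGroup A] [DecidableEq A] (D : Diagram) (f : ℕ → A) :
    Decidable (D.IsColoring f) :=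
  inferInstanceAs (Decidable (∀ P ∈ D, P.IsColored f))

theorem not_colorable_of_forall {A : Type*} [AddCommGroup A] {D : Diagram} (a : ℕ)
    (h : ∀ f : ℕ → A, D.IsColoring f → ∀ x ∈ D.labels, f x = f a) : ¬ Colorable A D := by
  rintro ⟨f, hf, x, hx, y, hy, hxy⟩
  exact hxy ((h f hf x hx).trans (h f hf y hy).symm)

theorem colorable_trefoil : Colorable (ZMod 3) trefoil :=
  ⟨fun x => if x = 0 ∨ x = 5 then 0 else if x = 1 ∨ x = 2 then 1 else 2, by decide, 0, by decide,
    1, by decide, by decide⟩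

theorem colorable_trefoil_mirror : Colorable (ZMod 3) trefoil.mirror :=
  ⟨fun x => if x = 0 ∨ x = 3 then 0 else if x = 1 ∨ x = 4 then 1 else 2, by decide, 0, by decide,
    1, by decide, by decide⟩

theorem colorable_hopfLink : Colorable (ZMod 2) hopfLink :=
  ⟨fun x => if x = 0 ∨ x = 3 then 0 else 1, by decide, 0, by decide, 1, by decide, by decide⟩

theorem colorable_hopfLink_mirror : Colorable (ZMod 2) hopfLink.mirror :=
  ⟨fun x => if x = 0 ∨ x = 3 then 0 else 1, by decide, 0, by decide, 1, by decide, by decide⟩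

theorem colorable_solomonKnot : Colorable (ZMod 2) solomonKnot :=
  ⟨fun x => if x = 0 ∨ x = 3 ∨ x = 4 ∨ x = 7 then 0 else 1, by decide, 0, by decide, 1, by decide,
    by decide⟩

theorem colorable_solomonKnot_mirror : Colorable (ZMod 2) solomonKnot.mirror :=
  ⟨fun x => if x = 0 ∨ x = 3 ∨ x = 4 ∨ x = 7 then 0 else 1, by decide, 0, by decide, 1, by decide,
    by decide⟩

/-- A colouring modulo 2 is constant on each component, and the trefoil has only one. -/
theorem not_colorable_trefoil : ¬ Colorable (ZMod 2) trefoil :=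
  not_colorable_of_forall 0 fun f hf => by
    simp [trefoil, IsColoring, IsColored, labels, ends] at hf ⊢
    grind

theorem not_colorable_trefoil_mirror : ¬ Colorable (ZMod 2) trefoil.mirror :=
  not_colorable_of_forall 0 fun f hf => by
    simp [trefoil, Diagram.mirror, Piece.mirror, IsColoring, IsColored, labels, ends] at hf ⊢
    grind

/-- Along the closure of `σ₁^k` the colours form an arithmetic progression that closes up after `k`
crossings, so `k` times its difference vanishes. For `k = 2`, and likewise `k = 4`, the difference
is zero modulo 3. -/
theorem not_colorable_hopfLink : ¬ Colorable (ZMod 3) hopfLink :=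
  not_colorable_of_forall 0 fun f hf => by
    simp [hopfLink, IsColoring, IsColored, labels, ends] at hf ⊢
    grind

theorem not_colorable_hopfLink_mirror : ¬ Colorable (ZMod 3) hopfLink.mirror :=
  not_colorable_of_forall 0 fun f hf => by
    simp [hopfLink, Diagram.mirror, Piece.mirror, IsColoring, IsColored, labels, ends] at hf ⊢
    grind

theorem not_colorable_solomonKnot : ¬ Colorable (ZMod 3) solomonKnot :=
  not_colorable_of_forall 0 fun f hf => by
    simp [solomonKnot, IsColoring, IsColored, labels, ends] at hf ⊢
    grind

theorem not_colorable_solomonKnot_mirror : ¬ Colorable (ZMod 3) solomonKnot.mirror :=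
  not_colorable_of_forall 0 fun f hf => by
    simp [solomonKnot, Diagram.mirror, Piece.mirror, IsColoring, IsColored, labels, ends] at hf ⊢
    grind

/-! ### Tile numbers -/

theorem Mosaic.tileNumber_le {n : ℕ} (M : Mosaic n) : M.tileNumber ≤ n * n := by
  refine (Finset.card_filter_le _ _).trans ?_
  simp

theorem Mosaic.twelve_le_tileNumber {n : ℕ} (M : Mosaic n) {D : Diagram}
    (h : M.Represents D.linkType) (hD : ¬(Colorable (ZMod 2) D ↔ Colorable (ZMod 3) D)) :
    12 ≤ M.tileNumber := by
  by_contra! hM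
  rw [← colorable_iff_of_linkType_eq h, ← colorable_iff_of_linkType_eq h] at hD
  exact hD ⟨M.colorable_three_of_two (by omega), M.colorable_two_of_three (by omega)⟩

theorem tileNumber_eq_twelve {D : Diagram} (hD : ¬(Colorable (ZMod 2) D ↔ Colorable (ZMod 3) D))
    {M : Mosaic 4} (hM : M.tileNumber = 12) (h : M.Represents D.linkType) :
    D.linkType.HasTileNumber 12 ∧ D.linkType.HasMinimalMosaicTileNumber 12 := by
  refine ⟨⟨⟨4, M, h, hM⟩, ?_⟩, 4, ⟨⟨M, h⟩, ?_⟩, ⟨M, h, hM⟩, ?_⟩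
  · rintro t ⟨n, M', h', rfl⟩
    exact M'.twelve_le_tileNumber h' hD
  · rintro n ⟨M', h'⟩
    have h1 := M'.twelve_le_tileNumber h' hD
    have h2 := M'.tileNumber_le
    -- For `n ≤ 3` there are at most nine tiles.
    by_contra! hn
    nlinarith
  · rintro t ⟨M', h', rfl⟩
    exact M'.twelve_le_tileNumber h' hD

end KnotMosaic

/-- Each of the trefoil, the Hopf link and Solomon's knot, in either of its two mirror forms, has
tile number `12` and minimal mosaic tile number `12`. -/
theorem mainTheorem8 (D : KnotMosaic.Diagram)
    (hD : D = KnotMosaic.trefoil ∨ D = KnotMosaic.hopfLink ∨ D = KnotMosaic.solomonKnot)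
    (K : KnotMosaic.LinkType) (hK : K = D.linkType ∨ K = D.mirror.linkType) :
    K.HasTileNumber 12 ∧ K.HasMinimalMosaicTileNumber 12 := by
  open KnotMosaic in
  rcases hD with rfl | rfl | rfl <;> rcases hK with rfl | rfl
  · exact tileNumber_eq_twelve (fun h => not_colorable_trefoil (h.2 colorable_trefoil))
      (tileNumber_ringMosaic _ _ _ _) linkType_ringMosaic_trefoil
  · exact tileNumber_eq_twelve (fun h => not_colorable_trefoil_mirror (h.2 colorable_trefoil_mirror))
      (tileNumber_ringMosaic _ _ _ _) linkType_ringMosaic_trefoil_mirror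
  · exact tileNumber_eq_twelve (fun h => not_colorable_hopfLink (h.1 colorable_hopfLink))
      (tileNumber_ringMosaic _ _ _ _) linkType_ringMosaic_hopfLink
  · exact tileNumber_eq_twelve
      (fun h => not_colorable_hopfLink_mirror (h.1 colorable_hopfLink_mirror))
      (tileNumber_ringMosaic _ _ _ _) linkType_ringMosaic_hopfLink_mirror
  · exact tileNumber_eq_twelve (fun h => not_colorable_solomonKnot (h.1 colorable_solomonKnot))
      (tileNumber_ringMosaic _ _ _ _) linkType_ringMosaic_solomonKnot
  · exact tileNumber_eq_twelve
      (fun h => not_colorable_solomonKnot_mirror (h.1 colorable_solomonKnot_mirror))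
      (tileNumber_ringMosaic _ _ _ _) linkType_ringMosaic_solomonKnot_mirror
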